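/- Let $k$ be a field of prime characteristic $p$ and let $G$ be a finite group whose order is divisible by $p$. Let $\mathrm{stmod}(kG)$ be the stable module category: its objects are the finitely generated left $kG$-modules and its morphism groups $\underline{\mathrm{Hom}}_{kG}(M,N)$ are the $kG$-linear maps modulo those that factor through a projective module. Let $\mathrm{thick}_G(k)$ be the smallest full subcategory of $\mathrm{stmod}(kG)$ that contains the trivial module $k$ and is closed under exact triangles and direct summands. Let $\cdots\to T^{-1}\to T^0\to T^1\to\cdots$ be a complete resolution of $k$ (an exact complex of finitely generated projective $kG$-modules with an isomorphism $\mathrm{coker}(T^{-1}\to T^0)\cong k$), and for $n\in\mathbb Z$ put $\Omega^n k=\mathrm{coker}(T^{-n-1}\to T^{-n})$. The Tate cohomology $\hat H^n(G,M)=\underline{\mathrm{Hom}}_{kG}(\Omega^n k,M)$, $n\in\mathbb Z$, of a module $M$ forms a graded module $\hat H^*(G,M)$ over the Tate cohomology ring $\hat H^*(G,k)$, i.e. the graded ring of homotopy classes of graded chain maps $T\to T$, whose elements of degree $m$ act through the maps $\Omega^{m+n}k\to\Omega^n k$ that they induce. Suppose that the generating hypothesis (GH) holds for $kG$, that is, the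 functor $\hat H^*(G,-)$ from $\mathrm{thick}_G(k)$ to the category of graded $\hat H^*(G,k)$-modules and degree-preserving homomorphisms is faithful. Then this functor is also full: for all $M,N$ in $\mathrm{thick}_G(k)$, every homomorphism of graded $\hat H^*(G,k)$-modules $\hat H^*(G,M)\to\hat H^*(G,N)$ is induced by a morphism $M\to N$ in $\mathrm{stmod}(kG)$. -/

import Mathlib

open CategoryTheory

universe w u

noncomputable section

/-! ## The stable module category -/

section Stable

variable (A : Type u) [Ring A]

/-- Two maps of finitely generated left `A`-modules are stably equivalent if their difference
factors through a finitely generated projective module. -/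
def stableRel : HomRel (FGModuleCat.{u} A) := fun X Y f g =>
  ∃ (Q : FGModuleCat.{u} A) (_ : Module.Projective A Q) (a : X ⟶ Q) (b : Q ⟶ Y), f - g = a ≫ b

lemma stableRel_add {X Y : FGModuleCat.{u} A} {f₁ f₂ g₁ g₂ : X ⟶ Y}
    (hf : stableRel A f₁ f₂) (hg : stableRel A g₁ g₂) : stableRel A (f₁ + g₁) (f₂ + g₂) := by
  obtain ⟨Q, hQ, a, b, h⟩ := hf
  obtain ⟨R, hR, c, d, h'⟩ := hg
  refine ⟨FGModuleCat.of A (Q × R), inferInstanceAs (Module.Projective A (Q × R)),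
    FGModuleCat.ofHom (a.hom.hom.prod c.hom.hom),
    FGModuleCat.ofHom (b.hom.hom.coprod d.hom.hom), ?_⟩
  have e : f₁ + g₁ - (f₂ + g₂) = (f₁ - f₂) + (g₁ - g₂) := by abel
  rw [e, h, h']
  ext x
  rfl

instance stableRel_congruence : Congruence (stableRel A) where
  equivalence := by
    intro X Y
    refine ⟨fun f => ⟨FGModuleCat.of A PUnit.{u + 1},
      inferInstanceAs (Module.Projective A PUnit.{u + 1}), 0, 0, by simp⟩, ?_, ?_⟩
    · rintro f g ⟨Q, hQ, a, b, h⟩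
      exact ⟨Q, hQ, a, -b, by rw [Preadditive.comp_neg, ← h]; abel⟩
    · rintro f g h hfg hgh
      obtain ⟨Q, hQ, a, b, e⟩ := stableRel_add A hfg hgh
      exact ⟨Q, hQ, a, b, by rw [← e]; abel⟩
  comp_left := by
    rintro X Y Z f g g' ⟨Q, hQ, a, b, h⟩
    exact ⟨Q, hQ, f ≫ a, b, by rw [← Preadditive.comp_sub, h, Category.assoc]⟩
  comp_right := by
    rintro X Y Z f f' g ⟨Q, hQ, a, b, h⟩
    exact ⟨Q, hQ, a, b ≫ g, by rw [← Preadditive.sub_comp, h, Category.assoc]⟩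

/-- The stable module category `stmod(A)`: its objects are the finitely generated left `A`-modules,
and its morphisms are the `A`-linear maps modulo those that factor through a projective module. -/
abbrev StMod := CategoryTheory.Quotient (stableRel A)

instance : Preadditive (StMod A) :=
  Quotient.preadditive (stableRel A) (fun _ _ _ _ _ _ hf hg => stableRel_add A hf hg)

/-- The projection from finitely generated modules to the stable module category. -/
abbrev StMod.proj : FGModuleCat.{u} A ⥤ StMod A := Quotient.functor (stableRel A)

instance : (StMod.proj A).Additive :=
  Quotient.functor_additive (stableRel A) (fun _ _ _ _ _ _ hf hg => stableRel_add A hf hg)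

lemma StMod.proj_map_eq_zero_of_factor {X Y : FGModuleCat.{u} A} (f : X ⟶ Y)
    (Q : FGModuleCat.{u} A) (hQ : Module.Projective A Q) (a : X ⟶ Q) (b : Q ⟶ Y)
    (h : f = a ≫ b) : (StMod.proj A).map f = 0 := by
  rw [← (StMod.proj A).map_zero]
  exact CategoryTheory.Quotient.sound _ ⟨Q, hQ, a, b, by rw [sub_zero, h]⟩

variable {A}

/-- `X ⟶ Y ⟶ Z` is part of an exact triangle `X ⟶ Y ⟶ Z ⟶ Ω⁻¹ X` of `stmod(A)` (for `A` the group
algebra of a finite group over a field): up to isomorphism in the stable category it comes from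
a short exact sequence of modules. This covers the rotations of such a triangle as well, and
the third map plays no role for closure properties of subcategories. -/
def StMod.IsTriangle {X Y Z : StMod A} (f : X ⟶ Y) (g : Y ⟶ Z) : Prop :=
  ∃ (L M N : FGModuleCat.{u} A) (i : L ⟶ M) (p : M ⟶ N),
    Function.Injective i.hom.hom ∧ Function.Exact i.hom.hom p.hom.hom ∧
    Function.Surjective p.hom.hom ∧
    ∃ (eX : X ≅ (StMod.proj A).obj L) (eY : Y ≅ (StMod.proj A).obj M)
      (eZ : Z ≅ (StMod.proj A).obj N),
      f ≫ eY.hom = eX.hom ≫ (StMod.proj A).map i ∧ g ≫ eZ.hom = eY.hom ≫ (StMod.proj A).map p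

/-- A (full, isomorphism closed) subcategory of `stmod(A)` is thick if it is closed under direct
summands and exact triangles: if two of the terms of an exact triangle belong to it,
then so does the third. -/
structure StMod.IsThick (P : ObjectProperty (StMod A)) : Prop where
  retract : P.IsStableUnderRetracts
  third : ∀ {X Y Z : StMod A} (f : X ⟶ Y) (g : Y ⟶ Z), StMod.IsTriangle f g → P X → P Y → P Z
  first : ∀ {X Y Z : StMod A} (f : X ⟶ Y) (g : Y ⟶ Z), StMod.IsTriangle f g → P Y → P Z → P X
  middle : ∀ {X Y Z : StMod A} (f : X ⟶ Y) (g : Y ⟶ Z), StMod.IsTriangle f g → P X → P Z → P Y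

/-- The thick subcategory of `stmod(A)` generated by `L`: the smallest thick subcategory
that contains `L`. -/
def StMod.thick (L : StMod A) : ObjectProperty (StMod A) := fun X =>
  ∀ P : ObjectProperty (StMod A), StMod.IsThick P → P L → P X

end Stable

/-! ## Graded modules over a graded ring -/

section Graded

open GradedMonoid DirectSum

variable (E : ℤ → Type u) [∀ i, AddCommGroup (E i)] [GRing E]

/-- A `ℤ`-graded left module over the `ℤ`-graded ring `E`. -/
structure GrMod where
  carrier : ℤ → Type w
  [addCommGroup : ∀ i, AddCommGroup (carrier i)]
  [gmodule : Gmodule E carrier]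

attribute [instance] GrMod.addCommGroup GrMod.gmodule

variable {E}

/-- A homomorphism of graded modules: an additive, `E`-linear map that preserves degrees. -/
@[ext]
structure GrMod.Hom (M N : GrMod.{w} E) where
  app : ∀ i, M.carrier i →+ N.carrier i
  map_smul : ∀ {i j : ℤ} (a : E i) (x : M.carrier j),
    app (i +ᵥ j) (GSMul.smul a x) = GSMul.smul a (app j x)

instance : Category (GrMod.{w} E) where
  Hom := GrMod.Hom
  id M := ⟨fun _ => AddMonoidHom.id _, fun _ _ => rfl⟩
  comp f g := ⟨fun i => (g.app i).comp (f.app i), fun a x => by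
    rw [AddMonoidHom.comp_apply, f.map_smul, g.map_smul, AddMonoidHom.comp_apply]⟩

end Graded

/-! ## The graded endomorphism ring of a complex, up to homotopy -/

section EndRing

open CochainComplex HomComplex

variable {C : Type*} [Category.{u} C] [Preadditive C]

/-- The composition of cocycles in the complexes of homomorphisms, as a biadditive map. -/
def cocycleComp {F G K : CochainComplex C ℤ} {m n p : ℤ} (h : m + n = p) :
    Cocycle F G m →+ Cocycle G K n →+ Cocycle F K p :=
  AddMonoidHom.mk'
    (fun a => AddMonoidHom.mk'
      (fun b => Cocycle.mk ((a : Cochain F G m).comp (b : Cochain G K n) h) (p + 1) rfl (by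
        rw [δ_comp _ _ h (m + 1) (n + 1) (p + 1) rfl rfl rfl]
        simp))
      (fun b b' => by ext; simp))
    (fun a a' => by ext; simp)

lemma cocycleComp_coe {F G K : CochainComplex C ℤ} {m n p : ℤ} (h : m + n = p)
    (a : Cocycle F G m) (b : Cocycle G K n) :
    (cocycleComp h a b : Cochain F K p) = (a : Cochain F G m).comp (b : Cochain G K n) h := rfl

/-- The composition of homotopy classes of graded chain maps: `classComp h a b` is `a` followed
by `b`. -/
def classComp {F G K : CochainComplex C ℤ} {m n p : ℤ} (h : m + n = p) :
    CohomologyClass F G m →+ CohomologyClass G K n →+ CohomologyClass F K p :=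
  CohomologyClass.descAddMonoidHom
    (AddMonoidHom.mk' (fun a => CohomologyClass.descAddMonoidHom
        ((CohomologyClass.mkAddMonoidHom F K p).comp (cocycleComp h a)) (by
          rintro b ⟨r, hr, β, hβ⟩
          obtain rfl : n = r + 1 := hr.symm
          rw [AddMonoidHom.mem_ker]
          change CohomologyClass.mk (cocycleComp h a b) = 0
          rw [CohomologyClass.mk_eq_zero_iff, mem_coboundaries_iff _ (m + r) (by omega)]
          refine ⟨(a : Cochain F G m).comp β rfl, ?_⟩
          rw [δ_comp _ _ rfl (m + 1) (r + 1) p (by omega) rfl rfl, hβ, cocycleComp_coe]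
          simp))
      (fun a a' => by
        ext b
        obtain ⟨b, rfl⟩ := b.mk_surjective
        simp)) (by
    rintro a ⟨r, hr, β, hβ⟩
    obtain rfl : m = r + 1 := hr.symm
    rw [AddMonoidHom.mem_ker]
    ext b
    obtain ⟨b, rfl⟩ := b.mk_surjective
    change CohomologyClass.mk (cocycleComp h a b) = 0
    rw [CohomologyClass.mk_eq_zero_iff, mem_coboundaries_iff _ (r + n) (by omega)]
    refine ⟨n.negOnePow • β.comp (b : Cochain G K n) rfl, ?_⟩
    rw [δ_units_smul, δ_comp _ _ rfl (r + 1) (n + 1) p (by omega) rfl rfl, hβ, cocycleComp_coe]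
    simp [smul_smul])

lemma classComp_mk {F G K : CochainComplex C ℤ} {m n p : ℤ} (h : m + n = p)
    (a : Cocycle F G m) (b : Cocycle G K n) :
    classComp h (CohomologyClass.mk a) (CohomologyClass.mk b) =
      CohomologyClass.mk (cocycleComp h a b) := rfl

variable (T : CochainComplex C ℤ)

/-- `EndClass T m` is the group of homotopy classes of graded chain maps `T ⟶ T` of degree `m`
(families of maps `T^p ⟶ T^{p+m}` that commute with the differentials up to the sign `(-1)^m`). -/
abbrev EndClass (m : ℤ) : Type u := CohomologyClass T T m

lemma EndClass.sigma_ext {i j : ℤ} (hij : i = j) (a : Cocycle T T i) (b : Cocycle T T j)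
    (h : ∀ (p q : ℤ) (hp : p + i = q), (a : Cochain T T i).v p q hp =
      (b : Cochain T T j).v p q (by omega)) :
    (⟨i, CohomologyClass.mk a⟩ : GradedMonoid (EndClass T)) = ⟨j, CohomologyClass.mk b⟩ := by
  subst hij
  congr 2
  ext p q hp
  exact h p q hp

/-- The unit is the class of the identity map. -/
instance EndClass.gone : GradedMonoid.GOne (EndClass T) where
  one := CohomologyClass.mk (Cocycle.ofHom (𝟙 T))

/-- The product `a * b` is `a` followed by `b`. -/
instance EndClass.gmul : GradedMonoid.GMul (EndClass T) where
  mul a b := classComp rfl a b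

instance EndClass.gmonoid : GradedMonoid.GMonoid (EndClass T) where
  one_mul := by
    rintro ⟨i, a⟩
    obtain ⟨a, rfl⟩ := a.mk_surjective
    refine EndClass.sigma_ext T (zero_add i) _ _ (fun p q hp => ?_)
    change ((Cochain.ofHom (𝟙 T)).comp (a : Cochain T T i) rfl).v p q hp = _
    rw [Cochain.comp_v _ _ _ p p q (by omega) (by omega)]
    simp
  mul_one := by
    rintro ⟨i, a⟩
    obtain ⟨a, rfl⟩ := a.mk_surjective
    refine EndClass.sigma_ext T (add_zero i) _ _ (fun p q hp => ?_)
    change ((a : Cochain T T i).comp (Cochain.ofHom (𝟙 T)) rfl).v p q hp = _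
    rw [Cochain.comp_v _ _ _ p q q (by omega) (by omega)]
    simp
  mul_assoc := by
    rintro ⟨i, a⟩ ⟨j, b⟩ ⟨l, c⟩
    obtain ⟨a, rfl⟩ := a.mk_surjective
    obtain ⟨b, rfl⟩ := b.mk_surjective
    obtain ⟨c, rfl⟩ := c.mk_surjective
    refine EndClass.sigma_ext T (add_assoc i j l) _ _ (fun p q hp => ?_)
    change (((a : Cochain T T i).comp (b : Cochain T T j) rfl).comp (c : Cochain T T l) rfl).v
        p q hp = ((a : Cochain T T i).comp ((b : Cochain T T j).comp (c : Cochain T T l) rfl)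
          rfl).v p q _
    rw [Cochain.comp_v _ _ _ p (p + i + j) q (by omega) (by omega),
      Cochain.comp_v _ _ _ p (p + i) (p + i + j) (by omega) (by omega),
      Cochain.comp_v _ _ _ p (p + i) q (by omega) (by omega),
      Cochain.comp_v _ _ _ (p + i) (p + i + j) q (by omega) (by omega), Category.assoc]

/-- The graded ring of homotopy classes of graded chain maps `T ⟶ T`. -/
instance EndClass.gring : DirectSum.GRing (EndClass T) where
  __ := EndClass.gmonoid T
  mul_zero a := map_zero (classComp rfl a)
  zero_mul b := DFunLike.congr_fun (map_zero (classComp rfl)) b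
  mul_add a b c := map_add (classComp rfl a) b c
  add_mul a b c := DFunLike.congr_fun (map_add (classComp rfl) a b) c
  natCast n := n • CohomologyClass.mk (Cocycle.ofHom (𝟙 T))
  natCast_zero := zero_smul _ _
  natCast_succ n := succ_nsmul _ n
  intCast n := n • CohomologyClass.mk (Cocycle.ofHom (𝟙 T))
  intCast_ofNat n := natCast_zsmul _ n
  intCast_negSucc_ofNat n := negSucc_zsmul _ n

end EndRing

/-! ## Cokernels of the differentials of a complex of modules -/

section Coker

open CochainComplex HomComplex

variable {A : Type u} [Ring A] (T : CochainComplex (FGModuleCat.{u} A) ℤ)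

/-- The cokernel of the differential `T^{p-1} ⟶ T^p`. -/
def coker (p : ℤ) : FGModuleCat.{u} A :=
  FGModuleCat.of A (T.X p ⧸ LinearMap.range (T.d (p - 1) p).hom.hom)

/-- The projection `T^p ⟶ coker (T^{p-1} ⟶ T^p)`. -/
def cokerπ (p : ℤ) : T.X p ⟶ coker T p :=
  FGModuleCat.ofHom (Submodule.mkQ (LinearMap.range (T.d (p - 1) p).hom.hom))

variable {T}

/-- The universal property of the cokernel. -/
def cokerDesc {p : ℤ} {Y : FGModuleCat.{u} A} (f : T.X p ⟶ Y) (hf : T.d (p - 1) p ≫ f = 0) :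
    coker T p ⟶ Y :=
  FGModuleCat.ofHom (Submodule.liftQ _ f.hom.hom (by
    rintro _ ⟨x, rfl⟩
    exact congrArg (fun g => g.hom.hom x) hf))

lemma cokerπ_desc {p : ℤ} {Y : FGModuleCat.{u} A} (f : T.X p ⟶ Y) (hf : T.d (p - 1) p ≫ f = 0) :
    cokerπ T p ≫ cokerDesc f hf = f := by
  ext x
  rfl

lemma coker_hom_ext {p : ℤ} {Y : FGModuleCat.{u} A} {f g : coker T p ⟶ Y}
    (h : cokerπ T p ≫ f = cokerπ T p ≫ g) : f = g := by
  ext x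
  obtain ⟨x, rfl⟩ := Submodule.mkQ_surjective _ x
  exact congrArg (fun g => g.hom.hom x) h

lemma d_cokerπ (p q : ℤ) : T.d p q ≫ cokerπ T q = 0 := by
  by_cases h : p + 1 = q
  · obtain rfl : p = q - 1 := by omega
    ext x
    exact (Submodule.Quotient.mk_eq_zero _).2 ⟨x, rfl⟩
  · rw [T.shape _ _ h, Limits.zero_comp]

lemma cocycle_d_comp_v {m : ℤ} (a : Cocycle T T m) (p q r s : ℤ) (h : q + m = r) (hp : p + 1 = q)
    (hs : s + 1 = r) :
    T.d p q ≫ (a : Cochain T T m).v q r h =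
      m.negOnePow • ((a : Cochain T T m).v p s (by omega) ≫ T.d s r) := by
  have e := Cochain.congr_v (Cocycle.δ_eq_zero a (m + 1)) p r (by omega)
  rw [δ_v m (m + 1) rfl _ p r _ s q (by omega) (by omega), Cochain.zero_v,
    Int.negOnePow_succ, Units.neg_smul, ← sub_eq_add_neg, sub_eq_zero] at e
  rw [e, smul_smul, Int.units_mul_self, one_smul]

/-- The map on cokernels induced by a graded chain map of degree `m`. -/
def cokerMap {m : ℤ} (a : Cocycle T T m) (p q : ℤ) (h : p + m = q) : coker T p ⟶ coker T q :=
  cokerDesc ((a : Cochain T T m).v p q h ≫ cokerπ T q) (by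
    rw [← Category.assoc, cocycle_d_comp_v a (p - 1) p q (q - 1) h (by omega) (by omega),
      Linear.units_smul_comp, Category.assoc, d_cokerπ, Limits.comp_zero, smul_zero])

lemma cokerπ_map {m : ℤ} (a : Cocycle T T m) (p q : ℤ) (h : p + m = q) :
    cokerπ T p ≫ cokerMap a p q h = (a : Cochain T T m).v p q h ≫ cokerπ T q :=
  cokerπ_desc _ _

/-- The map in the stable category induced by a graded chain map of degree `m` on cokernels;
it only depends on the homotopy class if the terms of the complex are projective. -/
def stableCokerMap (hT : ∀ p, Module.Projective A (T.X p)) {m : ℤ} (p q : ℤ) (h : p + m = q) :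
    EndClass T m →+ ((StMod.proj A).obj (coker T p) ⟶ (StMod.proj A).obj (coker T q)) :=
  CohomologyClass.descAddMonoidHom
    (AddMonoidHom.mk' (fun a => (StMod.proj A).map (cokerMap a p q h)) (fun a b => by
      rw [← Functor.map_add]
      congr 1
      apply coker_hom_ext
      simp [cokerπ_map])) (by
    rintro a ⟨r, hr, β, hβ⟩
    rw [AddMonoidHom.mem_ker]
    refine StMod.proj_map_eq_zero_of_factor A _ (T.X (p + 1)) (hT _)
      (cokerDesc (T.d p (p + 1)) (by simp))
      (m.negOnePow • (β.v (p + 1) q (by omega) ≫ cokerπ T q)) ?_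
    apply coker_hom_ext
    rw [cokerπ_map, ← hβ, δ_v r m hr _ p q h (q - 1) (p + 1) (by omega) rfl,
      Preadditive.add_comp, Category.assoc, d_cokerπ, Limits.comp_zero, zero_add,
      Linear.units_smul_comp, Category.assoc, ← Category.assoc (cokerπ T p), cokerπ_desc,
      Linear.comp_units_smul])

lemma stableCokerMap_mk (hT : ∀ p, Module.Projective A (T.X p)) {m : ℤ} (p q : ℤ) (h : p + m = q)
    (a : Cocycle T T m) :
    stableCokerMap hT p q h (CohomologyClass.mk a) = (StMod.proj A).map (cokerMap a p q h) := rfl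

lemma stableCokerMap_one (hT : ∀ p, Module.Projective A (T.X p)) (p : ℤ) :
    stableCokerMap hT p p (add_zero p) (CohomologyClass.mk (Cocycle.ofHom (𝟙 T))) = 𝟙 _ := by
  rw [stableCokerMap_mk, ← CategoryTheory.Functor.map_id]
  congr 1
  apply coker_hom_ext
  rw [cokerπ_map]
  simp

lemma stableCokerMap_comp (hT : ∀ p, Module.Projective A (T.X p)) {m n l : ℤ} (p q r : ℤ)
    (h : p + m = q) (h' : q + n = r) (hl : m + n = l) (a : EndClass T m) (b : EndClass T n) :
    stableCokerMap hT p r (by omega) (classComp hl a b) =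
      stableCokerMap hT p q h a ≫ stableCokerMap hT q r h' b := by
  obtain ⟨a, rfl⟩ := a.mk_surjective
  obtain ⟨b, rfl⟩ := b.mk_surjective
  rw [classComp_mk, stableCokerMap_mk, stableCokerMap_mk, stableCokerMap_mk, ← Functor.map_comp]
  congr 1
  apply coker_hom_ext
  rw [cokerπ_map, ← Category.assoc, cokerπ_map, Category.assoc, cokerπ_map, cocycleComp_coe,
    Cochain.comp_v _ _ hl p q r h h', Category.assoc]

end Coker

/-! ## Complete resolutions and Tate cohomology -/

section Tate

open CochainComplex HomComplex GradedMonoid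

variable {A : Type u} [Ring A]

/-- A complete resolution of the module `L`: an exact complex
`⋯ ⟶ T⁻² ⟶ T⁻¹ ⟶ T⁰ ⟶ T¹ ⟶ ⋯` of finitely generated projective modules, together with an
isomorphism of the cokernel of `T⁻¹ ⟶ T⁰` with `L`. (We only use this for group algebras of finite
groups over fields, where projective modules are injective, so that mapping such a complex
to a projective module gives an exact complex.) -/
structure CompleteResolution (L : FGModuleCat.{u} A) where
  complex : CochainComplex (FGModuleCat.{u} A) ℤ
  projective : ∀ p, Module.Projective A (complex.X p)
  exact : ∀ p q r : ℤ, p + 1 = q → q + 1 = r →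
    Function.Exact (complex.d p q).hom.hom (complex.d q r).hom.hom
  augmentation : coker complex 0 ≅ L

namespace CompleteResolution

variable {L : FGModuleCat.{u} A} (T : CompleteResolution L)

/-- The `n`-th syzygy `Ωⁿ L` (for any integer `n`), as an object of the stable category. -/
def syzygy (n : ℤ) : StMod A := (StMod.proj A).obj (coker T.complex (-n))

/-- For a complete resolution of the trivial module of `kG` this is the Tate cohomology ring
`Ĥ^*(G, k)`, with the composition product: the graded ring of homotopy classes of graded chain maps
from the complete resolution to itself. Sending `a` of degree `m` to the stable map
`Ω^m k ⟶ Ω^0 k ≅ k` that it induces identifies its degree `m` part with the group of stable maps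
`Ω^m k ⟶ k`, which is `Ĥ^m(G, k)`. (The product `a * b` is "`a`, then `b`", so that the ring acts
from the left by precomposition.) -/
abbrev ring (m : ℤ) : Type u := EndClass T.complex m

/-- The map `Ω^{m+n} L ⟶ Ω^n L` induced by an element of degree `m` of the Tate cohomology ring. -/
def syzygyMap {m n l : ℤ} (h : m + n = l) : T.ring m →+ (T.syzygy l ⟶ T.syzygy n) :=
  stableCokerMap T.projective (-l) (-n) (by omega)

/-- The graded module over the Tate cohomology ring with `n`-th graded piece the group of stable
maps `Ω^n L ⟶ X`. An element `a` of degree `m` takes `x : Ω^n L ⟶ X` to the composition of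
`Ω^{m+n} L ⟶ Ω^n L` (induced by `a`) and `x`. -/
instance gmodule (X : StMod A) : DirectSum.Gmodule T.ring (fun n : ℤ => T.syzygy n ⟶ X) where
  smul {i j} a x := T.syzygyMap (n := j) (l := i +ᵥ j) rfl a ≫ x
  one_smul := by
    rintro ⟨j, x⟩
    have key : ∀ (l : ℤ) (h : 0 + j = l),
        (⟨l, T.syzygyMap h (CohomologyClass.mk (Cocycle.ofHom (𝟙 _))) ≫ x⟩ :
          GradedMonoid (fun n : ℤ => T.syzygy n ⟶ X)) = ⟨j, x⟩ := by
      intro l h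
      obtain rfl : l = j := by omega
      congr 1
      exact (congrArg (· ≫ x) (stableCokerMap_one T.projective (-l))).trans (Category.id_comp x)
    exact key _ rfl
  mul_smul := by
    rintro ⟨i, a⟩ ⟨i', a'⟩ ⟨j, x⟩
    have key : ∀ (l l' : ℤ) (h : (i + i') + j = l) (h' : i + (i' + j) = l'),
        (⟨l, T.syzygyMap h (classComp rfl a a') ≫ x⟩ :
          GradedMonoid (fun n : ℤ => T.syzygy n ⟶ X)) =
        ⟨l', T.syzygyMap h' a ≫ T.syzygyMap rfl a' ≫ x⟩ := by
      intro l l' h h'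
      obtain rfl : l = l' := by omega
      congr 1
      rw [← Category.assoc]
      congr 1
      exact stableCokerMap_comp T.projective _ _ _ _ _ rfl a a'
    exact key _ _ rfl rfl
  smul_add a x y := Preadditive.comp_add _ _ _ _ _ _
  smul_zero a := Limits.comp_zero
  add_smul a a' x := by rw [map_add, Preadditive.add_comp]
  zero_smul x := by rw [map_zero, Limits.zero_comp]

/-- The functor `X ↦ the stable Hom(Ω^* L, X)` from the stable module category to graded modules.
For a complete resolution of the trivial module of `kG` this is the Tate cohomology functor
`X ↦ Ĥ^*(G, X)` to `Ĥ^*(G, k)`-modules. -/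
def tateCohomology : StMod A ⥤ GrMod.{u} T.ring where
  obj X := { carrier := fun n => T.syzygy n ⟶ X }
  map {X Y} f :=
    { app := fun n => AddMonoidHom.mk' (fun x => x ≫ f) (fun x y => Preadditive.add_comp _ _ _ _ _ _)
      map_smul := fun {i j} a x =>
        Category.assoc (T.syzygyMap (n := j) (l := i +ᵥ j) rfl a) x f }
  map_id X := by
    apply GrMod.Hom.ext
    funext n
    ext x
    exact Category.comp_id x
  map_comp f g := by
    apply GrMod.Hom.ext
    funext n
    ext x
    exact (Category.assoc x f g).symm

/-- The restriction of the Tate cohomology functor to the thick subcategory generated by `L`. -/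
def tateCohomologyThick :
    (StMod.thick ((StMod.proj A).obj L)).FullSubcategory ⥤ GrMod.{u} T.ring :=
  (StMod.thick ((StMod.proj A).obj L)).ι ⋙ T.tateCohomology

/-- The generating hypothesis: Tate cohomology detects trivial maps in the thick subcategory
generated by `L`, i.e. it is faithful there. -/
def GeneratingHypothesis : Prop := T.tateCohomologyThick.Faithful

end CompleteResolution

end Tate

/-! ## Group algebras -/

section Existence

variable {A : Type u} [Ring A]

/-- A short exact sequence `0 ⟶ K ⟶ P ⟶ N ⟶ 0` with `P` projective. -/
structure IsProjSES {K P N : FGModuleCat.{u} A} (i : K ⟶ P) (p : P ⟶ N) : Prop where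
  proj : Module.Projective A P
  inj : Function.Injective i.hom.hom
  exact : Function.Exact i.hom.hom p.hom.hom
  surj : Function.Surjective p.hom.hom

lemma exists_cover [IsNoetherianRing A] (N : FGModuleCat.{u} A) :
    ∃ (K P : FGModuleCat.{u} A) (i : K ⟶ P) (p : P ⟶ N), IsProjSES i p := by
  obtain ⟨n, f, hf⟩ := Module.Finite.exists_fin' A N
  refine ⟨FGModuleCat.of A (LinearMap.ker f), FGModuleCat.of A (Fin n → A),
    FGModuleCat.ofHom (LinearMap.ker f).subtype, FGModuleCat.ofHom f,
    inferInstanceAs (Module.Projective A (Fin n → A)), Subtype.val_injective, ?_, hf⟩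
  exact LinearMap.exact_subtype_ker_map f

lemma CompleteResolution.nonempty_of_embeds [IsNoetherianRing A]
    (hA : ∀ M : FGModuleCat.{u} A, ∃ (P : FGModuleCat.{u} A) (i : M ⟶ P),
      Module.Projective A P ∧ Function.Injective i.hom.hom) (L : FGModuleCat.{u} A) :
    Nonempty (CompleteResolution L) := by
  have hull : ∀ M : FGModuleCat.{u} A,
      ∃ (P N : FGModuleCat.{u} A) (i : M ⟶ P) (p : P ⟶ N), IsProjSES i p := by
    intro M
    obtain ⟨P, i, hP, hi⟩ := hA M
    refine ⟨P, FGModuleCat.of A (P ⧸ LinearMap.range i.hom.hom), i,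
      FGModuleCat.ofHom (LinearMap.range i.hom.hom).mkQ, hP, hi, ?_,
      Submodule.mkQ_surjective _⟩
    exact LinearMap.exact_map_mkQ_range i.hom.hom
  choose K P i p hp using exists_cover (A := A)
  choose H N j q hq using hull
  let Cn : ℕ → FGModuleCat.{u} A := fun n => Nat.rec L (fun _ X => K X) n
  let Dn : ℕ → FGModuleCat.{u} A := fun n => Nat.rec L (fun _ X => N X) n
  let Z : ℤ → FGModuleCat.{u} A := fun
    | .ofNat 0 => Cn 1
    | .ofNat (n + 1) => Dn n
    | .negSucc n => Cn (n + 2)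
  let X : ℤ → FGModuleCat.{u} A := fun
    | .ofNat 0 => P (Cn 0)
    | .ofNat (n + 1) => H (Dn n)
    | .negSucc n => P (Cn (n + 1))
  let ι : ∀ n : ℤ, Z n ⟶ X n := fun
    | .ofNat 0 => i (Cn 0)
    | .ofNat (n + 1) => j (Dn n)
    | .negSucc n => i (Cn (n + 1))
  let π : ∀ n : ℤ, X n ⟶ Z (n + 1) := fun
    | .ofNat 0 => p (Cn 0)
    | .ofNat (n + 1) => q (Dn n)
    | .negSucc 0 => p (Cn 1)
    | .negSucc (n + 1) => p (Cn (n + 2))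
  have h : ∀ n : ℤ, IsProjSES (ι n) (π n) := fun
    | .ofNat 0 => hp (Cn 0)
    | .ofNat (n + 1) => hq (Dn n)
    | .negSucc 0 => hp (Cn 1)
    | .negSucc (n + 1) => hp (Cn (n + 2))
  have hz : ∀ n, ι n ≫ π n = 0 := by
    intro n
    ext x
    exact (h n).exact.apply_apply_eq_zero x
  let T : CochainComplex (FGModuleCat.{u} A) ℤ := CochainComplex.of X (fun n => π n ≫ ι (n + 1))
    (fun n => by
      rw [Category.assoc, ← Category.assoc (ι (n + 1)), hz, Limits.zero_comp, Limits.comp_zero])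
  have hd : ∀ n, T.d n (n + 1) = π n ≫ ι (n + 1) := fun n =>
    CochainComplex.of_d X (fun n => π n ≫ ι (n + 1)) n
  refine ⟨⟨T, fun n => (h n).proj, ?_, ?_⟩⟩
  · rintro a _ _ rfl rfl
    rw [hd, hd]
    intro x
    constructor
    · intro hx
      obtain ⟨z, rfl⟩ := ((h (a + 1)).exact x).1 ((h (a + 1 + 1)).inj (hx.trans (map_zero _).symm))
      obtain ⟨y, rfl⟩ := (h a).surj z
      exact ⟨y, rfl⟩
    · rintro ⟨y, rfl⟩
      exact (congrArg (ι (a + 1 + 1)).hom.hom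
        ((h (a + 1)).exact.apply_apply_eq_zero ((π a).hom.hom y))).trans (map_zero _)
  · have key : ∀ a b : ℤ, a + 1 = b →
        LinearMap.range (T.d a b).hom.hom = LinearMap.ker (π b).hom.hom := by
      rintro a _ rfl
      rw [hd]
      ext x
      constructor
      · rintro ⟨y, rfl⟩
        exact (h (a + 1)).exact.apply_apply_eq_zero ((π a).hom.hom y)
      · intro hx
        obtain ⟨z, rfl⟩ := ((h (a + 1)).exact x).1 hx
        obtain ⟨y, rfl⟩ := (h a).surj z
        exact ⟨y, rfl⟩
    have hr := key (0 - 1) 0 (by omega)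
    exact ((Submodule.quotEquivOfEq _ _ hr).trans
      ((π 0).hom.hom.quotKerEquivOfSurjective (h 0).surj)).toFGModuleCatIso

end Existence

section GroupAlgebra

open MonoidAlgebra

variable (k G : Type u) [Field k] [Group G]

/-- The trivial `kG`-module `k`. -/
def trivialModule : FGModuleCat.{u} (MonoidAlgebra k G) :=
  haveI : Module.Finite (MonoidAlgebra k G) (Representation.trivial k G k).asModule :=
    Module.Finite.of_restrictScalars_finite k _ _
  FGModuleCat.of (MonoidAlgebra k G) (Representation.trivial k G k).asModule

lemma exists_embedding_of_fg [Finite G] (M : FGModuleCat.{u} (MonoidAlgebra k G)) :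
    ∃ (P : FGModuleCat.{u} (MonoidAlgebra k G)) (i : M ⟶ P),
      Module.Projective (MonoidAlgebra k G) P ∧ Function.Injective i.hom.hom := by
  classical
  have := Fintype.ofFinite G
  let _ : Module k M := Module.compHom M (algebraMap k (MonoidAlgebra k G))
  have : IsScalarTower k (MonoidAlgebra k G) M := by
    refine ⟨fun c a m => ?_⟩
    change (c • a) • m = algebraMap k (MonoidAlgebra k G) c • (a • m)
    rw [Algebra.smul_def, mul_smul]
  have : Module.Finite k (MonoidAlgebra k G) := inferInstance
  have : Module.Finite k M := Module.Finite.trans (MonoidAlgebra k G) M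
  let b := Module.finBasis k M
  let act : G → M →ₗ[k] M := fun g =>
    { toFun := fun m => (single g (1 : k) : MonoidAlgebra k G) • m
      map_add' := fun x y => smul_add _ _ _
      map_smul' := fun c x => by
        change (single g (1 : k) : MonoidAlgebra k G) • (algebraMap k (MonoidAlgebra k G) c • x) =
          algebraMap k (MonoidAlgebra k G) c • ((single g (1 : k) : MonoidAlgebra k G) • x)
        rw [← mul_smul, ← mul_smul, Algebra.commutes] }
  let e : Fin (Module.finrank k M) → M →ₗ[k] MonoidAlgebra k G := fun i =>
    ∑ g : G, (MonoidAlgebra.lsingle (R := k) g).comp ((b.coord i).comp (act g⁻¹))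
  have he : ∀ i m, e i m =
      ∑ g : G, single g (b.coord i ((single g⁻¹ (1 : k) : MonoidAlgebra k G) • m)) := by
    intro i m
    simp only [e, LinearMap.sum_apply]
    rfl
  have hcomm : ∀ i (h : G) m, e i ((single h (1 : k) : MonoidAlgebra k G) • m) =
      (single h (1 : k) : MonoidAlgebra k G) • e i m := by
    intro i h m
    rw [he, he, Finset.smul_sum]
    refine Fintype.sum_equiv (Equiv.mulLeft h⁻¹) _ _ (fun g => ?_)
    rw [← mul_smul, single_mul_single, smul_eq_mul, single_mul_single]
    simp
  let F : M →ₗ[MonoidAlgebra k G] (Fin (Module.finrank k M) → MonoidAlgebra k G) :=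
    LinearMap.pi (fun i => equivariantOfLinearOfComm (e i) (hcomm i))
  refine ⟨FGModuleCat.of _ (Fin (Module.finrank k M) → MonoidAlgebra k G), FGModuleCat.ofHom F,
    inferInstanceAs (Module.Projective _ (Fin (Module.finrank k M) → MonoidAlgebra k G)), ?_⟩
  change Function.Injective F
  rw [injective_iff_map_eq_zero]
  intro m hm
  rw [← b.repr.map_eq_zero_iff]
  ext i
  have h1 : e i m = 0 := congrFun hm i
  have h2 := congrArg (fun f : MonoidAlgebra k G => f.coeff 1) (he i m)
  rw [h1] at h2
  simp only [coeff_zero, Finsupp.coe_zero, Pi.zero_apply, coeff_sum, Finsupp.coe_finsetSum,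
    Finset.sum_apply, coeff_single, Finsupp.single_apply, Finset.sum_ite_eq', Finset.mem_univ,
    if_true, inv_one] at h2
  rw [← one_def, one_smul] at h2
  exact h2.symm

/-- The trivial module of a finite group has a complete resolution. -/
instance nonempty_completeResolution [Finite G] :
    Nonempty (CompleteResolution (trivialModule k G)) :=
  haveI : IsNoetherianRing (MonoidAlgebra k G) := IsNoetherianRing.of_finite k _
  CompleteResolution.nonempty_of_embeds (exists_embedding_of_fg k G) _

end GroupAlgebra

end

/-! Let φ : Ĥ(M) → Ĥ(N) be a homomorphism of graded modules, with M and N in the thick subcategory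
generated by L. Call g : N → I and ψ : M → I, with I in that subcategory, a good pair if ψ induces φ
followed by the map that g induces. If h : I → C is the cone of g (`exists_weakCokernel`), then the
composite M → I → C of ψ and h is zero on Tate cohomology, hence zero by the generating hypothesis,
so ψ factors as some f : M → N followed by g. Good pairs can be added by direct sums and Hom(M, N)
is finite dimensional; therefore a good pair for which g kills a minimal subspace of Hom(M, N)
yields one f that works for all good pairs at once.

There are enough good pairs because of Tate duality (`exists_duality`): Hom(Ωᵐ L, M) and Hom(M, Ωᵐ⁺¹
L) are dual, through one linear form on Hom(Ωᵐ L, Ωᵐ⁺¹ L). Every stable map between syzygies comes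
from the graded ring (`exists_syzygyMap_eq`), so φ commutes with all of them, and duality then
completes every g : N → Ωʲ L to a good pair (`exists_comp_eq_appHom_comp`). Duality also shows that
maps into syzygies separate the elements of Ĥ(N) (`eq_zero_of_comp_eq_zero`), so f induces φ.

Duality itself comes from traces. A projective P has a k-linear σ whose conjugates sum to the
identity, and tr(σvu) is a perfect pairing between Hom(P, M) and Hom(M, P)
(`tracePairing_isPerfPair`). Chasing it through 0 → ΩX → P → X → 0 gives the pairing on stable maps.
-/

noncomputable section

/-! ## Traces and equivariant maps -/

section Trace

open MonoidAlgebra LinearMap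

variable {k G : Type*} [Field k] [Group G]
variable {X : Type*} [AddCommGroup X] [Module k X] [Module (MonoidAlgebra k G) X]
  [IsScalarTower k (MonoidAlgebra k G) X]
variable {Y : Type*} [AddCommGroup Y] [Module k Y] [Module (MonoidAlgebra k G) Y]
  [IsScalarTower k (MonoidAlgebra k G) Y]
variable {Z : Type*} [AddCommGroup Z] [Module k Z] [Module (MonoidAlgebra k G) Z]
  [IsScalarTower k (MonoidAlgebra k G) Z]

instance finiteDimensional_equivariantMap [FiniteDimensional k X] [FiniteDimensional k Y] :
    FiniteDimensional k (X →ₗ[MonoidAlgebra k G] Y) :=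
  Module.Finite.of_injective (LinearMap.restrictScalarsₗ k (MonoidAlgebra k G) X Y k)
    (LinearMap.restrictScalars_injective k)

/-- Rank one maps suffice: for `w` = f(·)x the trace is f(u x). -/
lemma eq_zero_of_trace_comp_eq_zero [FiniteDimensional k X] [FiniteDimensional k Y]
    (u : X →ₗ[k] Y) (h : ∀ w : Y →ₗ[k] X, trace k X (w ∘ₗ u) = 0) : u = 0 := by
  ext x
  refine (Module.forall_dual_apply_eq_zero_iff k (u x)).1 (fun f => ?_)
  rw [← h (f.smulRight x), trace_comp_comm', ← trace_smulRight f (u x)]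
  congr 1
  ext y
  simp

/-- For `σ` with sum of conjugates the identity, the trace pairing between the equivariant maps
`X ⟶ Y` and `Y ⟶ X`. -/
def tracePairing (σ : X →ₗ[k] X) :
    (X →ₗ[MonoidAlgebra k G] Y) →ₗ[k] (Y →ₗ[MonoidAlgebra k G] X) →ₗ[k] k :=
  LinearMap.mk₂ k (fun u v => trace k X (σ ∘ₗ (v ∘ₗ u).restrictScalars k))
    (fun u u' v => by rw [← map_add, ← LinearMap.comp_add]; congr 2; ext; simp)
    (fun c u v => by rw [← map_smul, ← LinearMap.comp_smul]; congr 2; ext; simp [LinearMap.map_smul_of_tower])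
    (fun u v v' => by rw [← map_add, ← LinearMap.comp_add]; congr 2)
    (fun c u v => by rw [← map_smul, ← LinearMap.comp_smul]; congr 2)

lemma tracePairing_apply (σ : X →ₗ[k] X) (u : X →ₗ[MonoidAlgebra k G] Y)
    (v : Y →ₗ[MonoidAlgebra k G] X) :
    tracePairing σ u v = trace k X (σ ∘ₗ (v ∘ₗ u).restrictScalars k) := rfl

/-! ### Sums of conjugates and their compatibility with the trace -/

variable [Fintype G]

lemma sumOfConjugatesEquivariant_comp_left (a : Y →ₗ[MonoidAlgebra k G] Z) (h : X →ₗ[k] Y) :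
    (a.restrictScalars k ∘ₗ h).sumOfConjugatesEquivariant G =
      a ∘ₗ h.sumOfConjugatesEquivariant G := by
  ext x
  simp [sumOfConjugatesEquivariant_apply, conjugate_apply, map_sum]

lemma sumOfConjugatesEquivariant_comp_right (a : X →ₗ[MonoidAlgebra k G] Y) (h : Y →ₗ[k] Z) :
    (h ∘ₗ a.restrictScalars k).sumOfConjugatesEquivariant G =
      h.sumOfConjugatesEquivariant G ∘ₗ a := by
  ext x
  simp [sumOfConjugatesEquivariant_apply, conjugate_apply]

/-- By cyclicity of the trace, conjugating `h` by g has the same effect as conjugating `s` by g⁻¹;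
so summing conjugates is self-adjoint for the trace form. -/
lemma trace_sumOfConjugates_comp [FiniteDimensional k X] [FiniteDimensional k Y]
    (h : X →ₗ[k] Y) (s : Y →ₗ[k] X) :
    trace k Y (h.sumOfConjugates G ∘ₗ s) = trace k Y (h ∘ₗ s.sumOfConjugates G) := by
  have e₁ : h.sumOfConjugates G ∘ₗ s = ∑ g : G, h.conjugate g ∘ₗ s := by
    ext y
    simp [sumOfConjugates_apply]
  have e₂ : h ∘ₗ s.sumOfConjugates G = ∑ g : G, h ∘ₗ s.conjugate g := by
    ext y
    simp [sumOfConjugates_apply]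
  rw [e₁, e₂, map_sum, map_sum]
  refine Fintype.sum_equiv (Equiv.inv G) _ _ (fun g => ?_)
  simp only [conjugate, Equiv.inv_apply, inv_inv, LinearMap.comp_assoc]
  rw [trace_comp_comm']
  simp only [LinearMap.comp_assoc]

lemma trace_comp_of_sumOfConjugatesEquivariant [FiniteDimensional k X] [FiniteDimensional k Y]
    (h : X →ₗ[k] Y) (s : Y →ₗ[k] X) :
    trace k Y ((h.sumOfConjugatesEquivariant G).restrictScalars k ∘ₗ s) =
      trace k Y (h ∘ₗ (s.sumOfConjugatesEquivariant G).restrictScalars k) :=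
  trace_sumOfConjugates_comp h s

/-- One direction of Higman's criterion. On the group algebra, the conjugates of the projection to
the coefficient at 1 are the projections to the other coefficients, which sum to the identity. A
free module is handled coordinatewise, and a direct summand by compressing with its inclusion and
projection. -/
lemma exists_sumOfConjugatesEquivariant_eq_id [Module.Projective (MonoidAlgebra k G) X] :
    ∃ σ : X →ₗ[k] X, σ.sumOfConjugatesEquivariant G = LinearMap.id := by
  obtain ⟨s, hs⟩ := Module.projective_def.1 ‹Module.Projective (MonoidAlgebra k G) X›
  let e : MonoidAlgebra k G →ₗ[k] MonoidAlgebra k G :=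
    (MonoidAlgebra.lsingle (1 : G)) ∘ₗ (Finsupp.lapply 1) ∘ₗ (coeffLinearEquiv k).toLinearMap
  have he : e.sumOfConjugatesEquivariant G = LinearMap.id := by
    refine LinearMap.ext fun x => ?_
    have : ∀ g : G, e.conjugate g x = single g⁻¹ (x.coeff g⁻¹) := by
      intro g
      rw [conjugate_apply]
      change single g⁻¹ (1 : k) * single 1 ((single g (1 : k) * x).coeff 1) = _
      rw [single_mul_single, mul_one, one_mul, coeff_single_mul_apply, mul_one, one_mul]
    rw [sumOfConjugatesEquivariant_apply, Finset.sum_congr rfl (fun g _ => this g)]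
    refine (Equiv.sum_comp (Equiv.inv G) (fun g => single g (x.coeff g))).trans ?_
    ext g
    classical
    simp [coeff_single]
  let E : (X →₀ MonoidAlgebra k G) →ₗ[k] (X →₀ MonoidAlgebra k G) := Finsupp.mapRange.linearMap e
  have hE : E.sumOfConjugatesEquivariant G = LinearMap.id := by
    refine LinearMap.ext fun f => ?_
    ext1 x
    have := LinearMap.congr_fun he (f x)
    rw [sumOfConjugatesEquivariant_apply] at this ⊢
    rw [Finsupp.finsetSum_apply]
    exact this
  refine ⟨(Finsupp.linearCombination (MonoidAlgebra k G) _root_.id).restrictScalars k ∘ₗ E ∘ₗ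
    s.restrictScalars k, ?_⟩
  rw [sumOfConjugatesEquivariant_comp_left, sumOfConjugatesEquivariant_comp_right, hE]
  exact LinearMap.ext hs

/-- Projective modules over the group algebra are relatively injective. -/
lemma exists_extension_of_projective [Module.Projective (MonoidAlgebra k G) Z]
    (j : X →ₗ[MonoidAlgebra k G] Y) (hj : Function.Injective j) (f : X →ₗ[MonoidAlgebra k G] Z) :
    ∃ f' : Y →ₗ[MonoidAlgebra k G] Z, f' ∘ₗ j = f := by
  obtain ⟨σ, hσ⟩ := exists_sumOfConjugatesEquivariant_eq_id (k := k) (G := G) (X := Z)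
  obtain ⟨r, hr⟩ := (j.restrictScalars k).exists_leftInverse_of_injective
    (LinearMap.ker_eq_bot.2 hj)
  -- A k-linear retraction `r` of `j` extends `f` linearly; inserting `σ` and summing conjugates
  -- makes the extension equivariant without changing its restriction along `j`.
  refine ⟨(σ ∘ₗ f.restrictScalars k ∘ₗ r).sumOfConjugatesEquivariant G, ?_⟩
  rw [← sumOfConjugatesEquivariant_comp_right, LinearMap.comp_assoc, LinearMap.comp_assoc, hr,
    LinearMap.comp_id, sumOfConjugatesEquivariant_comp_right, hσ, LinearMap.id_comp]

/-- The pairings of different projectives are adjoint along every equivariant map `d`. For `d` the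
identity this says that the pairing does not depend on the choice of `σ`. -/
lemma tracePairing_comp [FiniteDimensional k X] [FiniteDimensional k Z]
    {σ : X →ₗ[k] X} (hσ : σ.sumOfConjugatesEquivariant G = LinearMap.id)
    {τ : Z →ₗ[k] Z} (hτ : τ.sumOfConjugatesEquivariant G = LinearMap.id)
    (d : X →ₗ[MonoidAlgebra k G] Z) (u : Z →ₗ[MonoidAlgebra k G] Y)
    (v : Y →ₗ[MonoidAlgebra k G] X) :
    tracePairing σ (u ∘ₗ d) v = tracePairing τ u (d ∘ₗ v) := by
  -- The conjugates of `t` sum to vud, so tr(σvud) = tr(t), and cyclicity moves `τ` to the front.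
  let t : X →ₗ[k] X := (v ∘ₗ u).restrictScalars k ∘ₗ τ ∘ₗ d.restrictScalars k
  have ht : t.sumOfConjugatesEquivariant G = v ∘ₗ u ∘ₗ d := by
    rw [sumOfConjugatesEquivariant_comp_left, sumOfConjugatesEquivariant_comp_right, hτ]
    rfl
  rw [tracePairing_apply, ← ht, ← trace_comp_of_sumOfConjugatesEquivariant, hσ, tracePairing_apply]
  change trace k X (((v ∘ₗ u).restrictScalars k ∘ₗ τ) ∘ₗ d.restrictScalars k) = _
  rw [trace_comp_comm', ← LinearMap.comp_assoc, trace_comp_comm']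
  rfl

variable [FiniteDimensional k X] [FiniteDimensional k Y]

lemma tracePairing_isPerfPair
    {σ : X →ₗ[k] X} (hσ : σ.sumOfConjugatesEquivariant G = LinearMap.id) :
    (tracePairing (G := G) (Y := Y) σ).IsPerfPair := by
  refine LinearMap.IsPerfPair.of_injective ?_ ?_
  · rw [injective_iff_map_eq_zero]
    intro u hu
    apply LinearMap.restrictScalars_injective k
    refine eq_zero_of_trace_comp_eq_zero _ (fun w => ?_)
    -- Pairing `u` with the sum of conjugates of an arbitrary linear `w` gives tr(wu): the sum can
    -- be shifted onto `σ`, where it is the identity.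
    have := LinearMap.congr_fun hu (w.sumOfConjugatesEquivariant G)
    rw [tracePairing_apply, ← sumOfConjugatesEquivariant_comp_right,
      ← trace_comp_of_sumOfConjugatesEquivariant, hσ] at this
    exact this
  · rw [injective_iff_map_eq_zero]
    intro v hv
    apply LinearMap.restrictScalars_injective k
    refine eq_zero_of_trace_comp_eq_zero _ (fun w => ?_)
    have := LinearMap.congr_fun hv (w.sumOfConjugatesEquivariant G)
    rw [LinearMap.flip_apply, tracePairing_apply, ← sumOfConjugatesEquivariant_comp_left,
      ← trace_comp_of_sumOfConjugatesEquivariant, hσ] at this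
    rw [trace_comp_comm']
    exact this

end Trace

/-! ## Tate duality for modules -/

set_option linter.unusedSectionVars false

lemma LinearMap.exists_comp_eq_of_exact {R : Type*} [Ring R] {X Y Z W : Type*} [AddCommGroup X]
    [Module R X] [AddCommGroup Y] [Module R Y] [AddCommGroup Z] [Module R Z] [AddCommGroup W]
    [Module R W] {i : X →ₗ[R] Y} {p : Y →ₗ[R] Z} (hi : Function.Injective i)
    (h : Function.Exact i p) (f : W →ₗ[R] Y) (hf : p ∘ₗ f = 0) :
    ∃ g : W →ₗ[R] X, i ∘ₗ g = f := by
  refine ⟨(LinearEquiv.ofInjective i hi).symm.toLinearMap ∘ₗ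
    f.codRestrict (LinearMap.range i) (fun w => (h _).1 (LinearMap.congr_fun hf w)), ?_⟩
  ext w
  exact congrArg Subtype.val ((LinearEquiv.ofInjective i hi).apply_symm_apply _)

lemma LinearMap.exists_comp_eq_of_ker_le {R : Type*} [Ring R] {X Y Z : Type*} [AddCommGroup X]
    [Module R X] [AddCommGroup Y] [Module R Y] [AddCommGroup Z] [Module R Z]
    {p : X →ₗ[R] Y} (hp : Function.Surjective p) (f : X →ₗ[R] Z)
    (h : LinearMap.ker p ≤ LinearMap.ker f) : ∃ g : Y →ₗ[R] Z, g ∘ₗ p = f := by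
  refine ⟨(LinearMap.ker p).liftQ f h ∘ₗ (p.quotKerEquivOfSurjective hp).symm.toLinearMap, ?_⟩
  ext x
  have : (p.quotKerEquivOfSurjective hp).symm (p x) = Submodule.Quotient.mk x := by
    rw [LinearEquiv.symm_apply_eq]
    rfl
  change (LinearMap.ker p).liftQ f h ((p.quotKerEquivOfSurjective hp).symm (p x)) = f x
  rw [this]
  rfl

section Duality

open MonoidAlgebra LinearMap

variable {k G : Type*} [Field k] [Group G]
variable {X : Type*} [AddCommGroup X] [Module k X] [Module (MonoidAlgebra k G) X]
  [IsScalarTower k (MonoidAlgebra k G) X]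
variable {Y : Type*} [AddCommGroup Y] [Module k Y] [Module (MonoidAlgebra k G) Y]
  [IsScalarTower k (MonoidAlgebra k G) Y]
variable {M : Type*} [AddCommGroup M] [Module k M] [Module (MonoidAlgebra k G) M]
  [IsScalarTower k (MonoidAlgebra k G) M]
variable {P : Type*} [AddCommGroup P] [Module k P] [Module (MonoidAlgebra k G) P]
  [IsScalarTower k (MonoidAlgebra k G) P]
variable {Q : Type*} [AddCommGroup Q] [Module k Q] [Module (MonoidAlgebra k G) Q]
  [IsScalarTower k (MonoidAlgebra k G) Q]

/-- The linear form on the maps `X ⟶ Y` attached to a short exact sequence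
`0 ⟶ Y ⟶ P ⟶ X ⟶ 0` and an endomorphism `σ` of `P` with sum of conjugates the identity. -/
def syzygyTrace (σ : P →ₗ[k] P) (i : Y →ₗ[MonoidAlgebra k G] P)
    (π : P →ₗ[MonoidAlgebra k G] X) : (X →ₗ[MonoidAlgebra k G] Y) →ₗ[k] k where
  toFun w := tracePairing σ (w ∘ₗ π) i
  map_add' w w' := by rw [LinearMap.add_comp, map_add, LinearMap.add_apply]
  map_smul' c w := by
    have : (c • w) ∘ₗ π = c • (w ∘ₗ π) := rfl
    rw [this, map_smul, LinearMap.smul_apply, RingHom.id_apply]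

lemma syzygyTrace_comp (σ : P →ₗ[k] P) (i : Y →ₗ[MonoidAlgebra k G] P)
    (π : P →ₗ[MonoidAlgebra k G] X) (x : X →ₗ[MonoidAlgebra k G] M)
    (ψ : M →ₗ[MonoidAlgebra k G] Y) :
    syzygyTrace σ i π (ψ ∘ₗ x) = tracePairing σ (x ∘ₗ π) (i ∘ₗ ψ) := rfl

variable [Fintype G] [FiniteDimensional k P] [FiniteDimensional k Q]

/-- Adjointness moves the pairing from P to Q, where the composite Y → P → X occurs, which is zero.
Hence the form descends to stable maps. -/
lemma syzygyTrace_eq_zero_of_factor [Module.Projective (MonoidAlgebra k G) Q]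
    {σ : P →ₗ[k] P} (hσ : σ.sumOfConjugatesEquivariant G = LinearMap.id)
    {i : Y →ₗ[MonoidAlgebra k G] P} {π : P →ₗ[MonoidAlgebra k G] X} (hi : π ∘ₗ i = 0)
    (a : X →ₗ[MonoidAlgebra k G] Q) (b : Q →ₗ[MonoidAlgebra k G] Y) :
    syzygyTrace σ i π (b ∘ₗ a) = 0 := by
  obtain ⟨τ, hτ⟩ := exists_sumOfConjugatesEquivariant_eq_id (k := k) (G := G) (X := Q)
  have h := tracePairing_comp hσ hτ (a ∘ₗ π) LinearMap.id (i ∘ₗ b)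
  have h0 : (a ∘ₗ π) ∘ₗ i ∘ₗ b = 0 := by
    ext x
    exact (congrArg a (LinearMap.congr_fun hi (b x))).trans (map_zero a)
  rw [LinearMap.id_comp, h0, map_zero] at h
  exact h

variable [FiniteDimensional k M]

/-- Every linear form on the stable maps `X ⟶ M` is given by composition with a map `M ⟶ Y`. -/
lemma exists_syzygyTrace_eq [Module.Projective (MonoidAlgebra k G) Q]
    {σ : P →ₗ[k] P} (hσ : σ.sumOfConjugatesEquivariant G = LinearMap.id)
    {i : Y →ₗ[MonoidAlgebra k G] P} {π : P →ₗ[MonoidAlgebra k G] X}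
    (hi : Function.Injective i) (hex : Function.Exact i π) (hπ : Function.Surjective π)
    {j : X →ₗ[MonoidAlgebra k G] Q} (hj : Function.Injective j)
    (l : (X →ₗ[MonoidAlgebra k G] M) →ₗ[k] k)
    (hl : ∀ z : Q →ₗ[MonoidAlgebra k G] M, l (z ∘ₗ j) = 0) :
    ∃ ψ : M →ₗ[MonoidAlgebra k G] Y, ∀ x, syzygyTrace σ i π (ψ ∘ₗ x) = l x := by
  obtain ⟨τ, hτ⟩ := exists_sumOfConjugatesEquivariant_eq_id (k := k) (G := G) (X := Q)
  have := tracePairing_isPerfPair (Y := M) hσ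
  have := tracePairing_isPerfPair (Y := M) hτ
  -- Composition with `π` embeds Hom(X, M) in Hom(P, M), so `l` extends to a form there, which the
  -- perfect pairing represents by some `y` : M → P. The condition on `l` forces `y` into the kernel
  -- Y of `π`.
  obtain ⟨l', hl'⟩ := LinearMap.dualMap_surjective_of_injective
    (f := LinearMap.lcomp k M π) (fun a b h => by
      ext x
      obtain ⟨x, rfl⟩ := hπ x
      exact LinearMap.congr_fun h x) l
  replace hl' : ∀ x, l' (x ∘ₗ π) = l x := LinearMap.congr_fun hl'
  obtain ⟨y, hy⟩ := (IsPerfPair.bijective_right (tracePairing (G := G) (Y := M) σ)).2 l'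
  replace hy : ∀ u, tracePairing σ u y = l' u := LinearMap.congr_fun hy
  have hy0 : j ∘ₗ π ∘ₗ y = 0 := by
    apply (IsPerfPair.bijective_right (tracePairing (G := G) (Y := M) τ)).1
    rw [map_zero]
    ext z
    rw [LinearMap.flip_apply, ← LinearMap.comp_assoc, ← tracePairing_comp hσ hτ,
      ← LinearMap.comp_assoc, hy, hl', hl, LinearMap.zero_apply]
  obtain ⟨ψ, hψ⟩ := LinearMap.exists_comp_eq_of_exact hi hex y (by
    ext m
    exact hj ((LinearMap.congr_fun hy0 m).trans (map_zero j).symm))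
  exact ⟨ψ, fun x => by rw [syzygyTrace_comp, hψ, hy, hl']⟩

/-- The stable pairing is nondegenerate in the second variable. -/
lemma exists_factor_of_syzygyTrace_eq_zero [Module.Projective (MonoidAlgebra k G) Q]
    {σ : P →ₗ[k] P} (hσ : σ.sumOfConjugatesEquivariant G = LinearMap.id)
    {i : Y →ₗ[MonoidAlgebra k G] P} {π : P →ₗ[MonoidAlgebra k G] X}
    (hi : Function.Injective i) (hex : Function.Exact i π) (hπ : Function.Surjective π)
    {q : Q →ₗ[MonoidAlgebra k G] Y} (hq : Function.Surjective q)
    (y : M →ₗ[MonoidAlgebra k G] Y)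
    (hy : ∀ a : X →ₗ[MonoidAlgebra k G] M, syzygyTrace σ i π (y ∘ₗ a) = 0) :
    ∃ v : M →ₗ[MonoidAlgebra k G] Q, y = q ∘ₗ v := by
  obtain ⟨τ, hτ⟩ := exists_sumOfConjugatesEquivariant_eq_id (k := k) (G := G) (X := Q)
  have := tracePairing_isPerfPair (Y := M) hσ
  have := tracePairing_isPerfPair (Y := M) hτ
  -- The form on Hom(P, M) given by iy vanishes on every u with uiq = 0, since such a u factors
  -- through `π`. So it comes from a form on Hom(Q, M), which is represented by the required `v`.
  have hmem : (tracePairing σ).flip (i ∘ₗ y) ∈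
      LinearMap.range (LinearMap.lcomp k M (i ∘ₗ q)).dualMap := by
    rw [LinearMap.range_dualMap_eq_dualAnnihilator_ker, Submodule.mem_dualAnnihilator]
    intro u hu
    have hu0 : u ∘ₗ i = 0 := by
      ext z
      obtain ⟨z, rfl⟩ := hq z
      exact LinearMap.congr_fun hu z
    have hker : LinearMap.ker π ≤ LinearMap.ker u := by
      intro z hz
      obtain ⟨z, rfl⟩ := (hex z).1 hz
      exact LinearMap.congr_fun hu0 z
    obtain ⟨a, ha⟩ := LinearMap.exists_comp_eq_of_ker_le hπ u hker
    rw [← ha, LinearMap.flip_apply, ← syzygyTrace_comp]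
    exact hy a
  obtain ⟨μ, hμ⟩ := hmem
  replace hμ : ∀ u, μ (u ∘ₗ i ∘ₗ q) = tracePairing σ u (i ∘ₗ y) := LinearMap.congr_fun hμ
  obtain ⟨v, hv⟩ := (IsPerfPair.bijective_right (tracePairing (G := G) (Y := M) τ)).2 μ
  replace hv : ∀ u, tracePairing τ u v = μ u := LinearMap.congr_fun hv
  refine ⟨v, ?_⟩
  have key : i ∘ₗ y = (i ∘ₗ q) ∘ₗ v := by
    apply (IsPerfPair.bijective_right (tracePairing (G := G) (Y := M) σ)).1
    ext u
    rw [LinearMap.flip_apply, LinearMap.flip_apply, ← hμ, ← hv, tracePairing_comp hτ hσ]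
  ext m
  exact hi (LinearMap.congr_fun key m)

end Duality

/-! ## Lifting maps between syzygies to a complete resolution -/

lemma Int.exists_section {F : ℤ → Type*} (R : ∀ r q : ℤ, F r → F q → Prop)
    (up : ∀ r q, r + 1 = q → ∀ f : F r, ∃ f' : F q, R r q f f')
    (down : ∀ r q, r + 1 = q → ∀ f' : F q, ∃ f : F r, R r q f f') (p : ℤ) (x : F p) :
    ∃ s : ∀ r, F r, s p = x ∧ ∀ r q, r + 1 = q → R r q (s r) (s q) := by
  choose u hu using up
  choose d hd using down
  let s : ∀ r, F r := fun r => r.inductionOn' p x (fun r _ f => u r (r + 1) rfl f)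
    (fun r _ f => d (r - 1) r (by omega) f)
  refine ⟨s, Int.inductionOn'_self, ?_⟩
  rintro r _ rfl
  by_cases h : p ≤ r
  · have e : s (r + 1) = u r (r + 1) rfl (s r) := Int.inductionOn'_add_one h
    rw [e]
    exact hu _ _ _ _
  · obtain ⟨q, rfl⟩ : ∃ q, r = q - 1 := ⟨r + 1, by omega⟩
    have e : s (q - 1) = d (q - 1) q (by omega) (s q) := Int.inductionOn'_sub_one (by omega)
    have key : ∀ q', q - 1 + 1 = q' → q = q' → R (q - 1) q' (s (q - 1)) (s q') := by
      rintro _ - rfl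
      rw [e]
      exact hd _ _ _ _
    exact key _ rfl (by omega)

section Lifting

open CochainComplex HomComplex

variable {A : Type u} [Ring A] (T : CochainComplex (FGModuleCat.{u} A) ℤ)

lemma cokerπ_surjective (p : ℤ) : Function.Surjective (cokerπ T p).hom.hom :=
  Submodule.mkQ_surjective _

/-- The map `coker (T^{p-1} ⟶ T^p) ⟶ T^{p+1}` induced by the differential. -/
def cokerι (p q : ℤ) : coker T p ⟶ T.X q :=
  cokerDesc (T.d p q) (T.d_comp_d _ _ _)

lemma cokerπ_ι (p q : ℤ) : cokerπ T p ≫ cokerι T p q = T.d p q := cokerπ_desc _ _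

lemma cokerι_π (p q : ℤ) : cokerι T p q ≫ cokerπ T q = 0 := by
  apply coker_hom_ext
  rw [← Category.assoc, cokerπ_ι, d_cokerπ, Limits.comp_zero]

variable {T}

/-- With `cokerι_exact` this gives the short exact sequences 0 → coker p → T^{p+1} → coker (p+1) → 0
into which an exact complex splits. -/
lemma cokerι_injective (p q : ℤ)
    (hex : Function.Exact (T.d (p - 1) p).hom.hom (T.d p q).hom.hom) :
    Function.Injective (cokerι T p q).hom.hom := by
  rw [injective_iff_map_eq_zero]
  intro x hx
  obtain ⟨x, rfl⟩ := cokerπ_surjective T p x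
  obtain ⟨y, rfl⟩ := (hex x).1 hx
  exact congrArg (fun f => f.hom.hom y) (d_cokerπ (T := T) (p - 1) p)

lemma cokerι_exact (p q : ℤ) (h : p + 1 = q) :
    Function.Exact (cokerι T p q).hom.hom (cokerπ T q).hom.hom := by
  obtain rfl : p = q - 1 := by omega
  intro x
  constructor
  · intro hx
    obtain ⟨y, rfl⟩ := (Submodule.Quotient.mk_eq_zero _).1 hx
    exact ⟨(cokerπ T _).hom.hom y, rfl⟩
  · rintro ⟨y, rfl⟩
    exact congrArg (fun f => f.hom.hom y) (cokerι_π T (q - 1) q)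

/-- If the projective modules are injective relative to finitely generated modules, then every map
between cokernels of the differentials of an exact complex of projective modules is induced by
a graded chain map. -/
lemma exists_cokerMap_eq
    (hinj : ∀ {X Y Q : FGModuleCat.{u} A} (j : X ⟶ Y), Function.Injective j.hom.hom →
      Module.Projective A Q → ∀ f : X ⟶ Q, ∃ f' : Y ⟶ Q, j ≫ f' = f)
    (hT : ∀ p, Module.Projective A (T.X p))
    (hex : ∀ p q r : ℤ, p + 1 = q → q + 1 = r →
      Function.Exact (T.d p q).hom.hom (T.d q r).hom.hom)
    {m : ℤ} (p q : ℤ) (h : p + m = q) (f : coker T p ⟶ coker T q) :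
    ∃ a : Cocycle T T m, cokerMap a p q h = f := by
  subst h
  -- Maps on consecutive cokernels are related if some `b` in between covers the later one and
  -- restricts to the earlier one, up to the sign (-1)^m required of a cocycle of degree m.
  let R : ∀ r q : ℤ, (coker T r ⟶ coker T (r + m)) → (coker T q ⟶ coker T (q + m)) → Prop :=
    fun r q f f' => ∃ b : T.X q ⟶ T.X (q + m), b ≫ cokerπ T (q + m) = cokerπ T q ≫ f' ∧
      cokerι T r q ≫ b = m.negOnePow • (f ≫ cokerι T (r + m) (q + m))
  obtain ⟨s, hs, hR⟩ := Int.exists_section R (by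
      rintro r q hr f
      -- To the right: relative injectivity extends the map to the projective terms, then it passes
      -- to cokernels.
      obtain ⟨b, hb⟩ := hinj (cokerι T r q) (cokerι_injective r q (hex _ _ _ (by omega) hr))
        (hT (q + m)) (m.negOnePow • (f ≫ cokerι T (r + m) (q + m)))
      obtain rfl : r = q - 1 := by omega
      refine ⟨cokerDesc (b ≫ cokerπ T (q + m)) ?_, b, (cokerπ_desc _ _).symm, hb⟩
      rw [← cokerπ_ι, Category.assoc, ← Category.assoc (cokerι T _ _), hb,
        Linear.units_smul_comp, Category.assoc, cokerι_π, Limits.comp_zero, smul_zero,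
        Limits.comp_zero]) (by
      rintro r q hr f'
      -- To the left: projectivity lifts the map to the projective terms, then it restricts to
      -- kernels.
      obtain ⟨b, hb⟩ := Module.projective_lifting_property (cokerπ T (q + m)).hom.hom
        (cokerπ T q ≫ f').hom.hom (cokerπ_surjective T _) (h := hT q)
      have hb' : FGModuleCat.ofHom b ≫ cokerπ T (q + m) = cokerπ T q ≫ f' :=
        FGModuleCat.hom_ext hb
      have h0 : (cokerι T r q ≫ FGModuleCat.ofHom b) ≫ cokerπ T (q + m) = 0 := by
        rw [Category.assoc, hb', ← Category.assoc, cokerι_π, Limits.zero_comp]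
      obtain ⟨g, hg⟩ := LinearMap.exists_comp_eq_of_exact
        (cokerι_injective (r + m) (q + m) (hex _ _ _ (by omega) (by omega)))
        (cokerι_exact (r + m) (q + m) (by omega))
        (cokerι T r q ≫ FGModuleCat.ofHom b).hom.hom (congrArg (fun f => f.hom.hom) h0)
      have hg' : FGModuleCat.ofHom g ≫ cokerι T (r + m) (q + m) =
        cokerι T r q ≫ FGModuleCat.ofHom b := FGModuleCat.hom_ext hg
      refine ⟨m.negOnePow • FGModuleCat.ofHom g, FGModuleCat.ofHom b, hb', ?_⟩
      rw [Linear.units_smul_comp, smul_smul, Int.units_mul_self, one_smul]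
      exact hg'.symm) p f
  choose b hb hb' using fun q => hR (q - 1) q (by omega)
  let z : Cochain T T m := Cochain.mk (fun p q h => b p ≫ (T.XIsoOfEq h).hom)
  have hz : ∀ p, z.v p (p + m) rfl = b p := fun p => by
    simp [z]
  have hd : ∀ (r q t l : ℤ) (hr : r + 1 = q) (ht : r + m = t) (hl : q + m = l),
      T.d r q ≫ z.v q l hl = m.negOnePow • (z.v r t ht ≫ T.d t l) := by
    rintro r q _ _ hr rfl rfl
    obtain rfl : r = q - 1 := by omega
    rw [hz, hz, ← cokerπ_ι, ← cokerπ_ι, Category.assoc, hb', Linear.comp_units_smul,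
      ← Category.assoc, ← Category.assoc, hb]
  refine ⟨Cocycle.mk z (m + 1) rfl ?_, ?_⟩
  · ext r l hl
    rw [δ_v m (m + 1) rfl z r l hl (l - 1) (r + 1) rfl rfl,
      hd r (r + 1) (l - 1) l rfl (by omega) (by omega),
      Int.negOnePow_succ, Units.neg_smul, smul_smul, Int.units_mul_self, one_smul,
      add_neg_cancel, Cochain.zero_v]
  · apply coker_hom_ext
    rw [cokerπ_map]
    change z.v p (p + m) rfl ≫ _ = _
    rw [hz, hb, hs]

end Lifting

/-! ## The stable category as a linear category -/

section StableLinear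

open scoped ModuleCat

variable {k : Type u} [Field k] {A : Type u} [Ring A] [Algebra k A]

instance StMod.linear : Linear k (StMod A) :=
  Quotient.linear k (stableRel A) (by
    rintro c X Y f g ⟨Q, hQ, a, b, h⟩
    exact ⟨Q, hQ, a, c • b, by rw [← smul_sub, h, Linear.comp_smul]⟩)

instance StMod.proj_linear : (StMod.proj A).Linear k :=
  Quotient.linear_functor k (stableRel A) _

lemma StMod.proj_map_eq_zero_iff {X Y : FGModuleCat.{u} A} (f : X ⟶ Y) :
    (StMod.proj A).map f = 0 ↔ ∃ (Q : FGModuleCat.{u} A) (_ : Module.Projective A Q) (a : X ⟶ Q)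
      (b : Q ⟶ Y), f = a ≫ b := by
  rw [← (StMod.proj A).map_zero, Quotient.functor_map_eq_iff]
  simp only [stableRel, sub_zero]

instance FGModuleCat.finiteDimensional [FiniteDimensional k A] (X : FGModuleCat.{u} A) :
    FiniteDimensional k X :=
  Module.Finite.trans A X

/-- Linear maps as morphisms of finitely generated modules. -/
def FGModuleCat.homOfLinear (X Y : FGModuleCat.{u} A) : (X →ₗ[A] Y) →ₗ[k] (X ⟶ Y) where
  toFun f := FGModuleCat.ofHom f
  map_add' _ _ := rfl
  map_smul' _ _ := rfl

/-- Makes Hom(M, N) Artinian, as needed to choose a minimal kernel in the proof of fullness. -/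
instance StMod.finiteDimensional_hom [FiniteDimensional k A] (X Y : StMod A) :
    FiniteDimensional k (X ⟶ Y) := by
  let e : (X.as ⟶ Y.as) →ₗ[k] (X.as →ₗ[k] Y.as) :=
    { toFun := fun f => f.hom.hom.restrictScalars k
      map_add' := fun f g => rfl
      map_smul' := fun c f => rfl }
  have he : Function.Injective e := fun f g h =>
    FGModuleCat.hom_ext (LinearMap.restrictScalars_injective k h)
  have := Module.Finite.of_injective e he
  exact Module.Finite.of_surjective ((StMod.proj A).mapLinearMap k (X := X.as) (Y := Y.as))
    (StMod.proj A).map_surjective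

end StableLinear

/-! ## Tate duality in the stable category -/

section StableDuality

open scoped ModuleCat

variable {k G : Type u} [Field k] [Group G] [Finite G]

lemma exists_extension_to_projective {X Y Q : FGModuleCat.{u} (MonoidAlgebra k G)} (j : X ⟶ Y)
    (hj : Function.Injective j.hom.hom) (hQ : Module.Projective (MonoidAlgebra k G) Q)
    (f : X ⟶ Q) : ∃ f' : Y ⟶ Q, j ≫ f' = f := by
  cases nonempty_fintype G
  obtain ⟨f', hf'⟩ := exists_extension_of_projective j.hom.hom hj f.hom.hom
  exact ⟨FGModuleCat.ofHom f', FGModuleCat.hom_ext hf'⟩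

/-- Here coker r is the syzygy of coker p, with T^p between them; coker p embeds in T^{p+1} and T^r
maps onto coker r. The form `τ` is chosen before `M`, so a single form serves for all modules. -/
lemma exists_stable_duality {T : CochainComplex (FGModuleCat.{u} (MonoidAlgebra k G)) ℤ}
    (hT : ∀ p, Module.Projective (MonoidAlgebra k G) (T.X p))
    (hex : ∀ p q r : ℤ, p + 1 = q → q + 1 = r →
      Function.Exact (T.d p q).hom.hom (T.d q r).hom.hom) (p r : ℤ) (h : r + 1 = p) :
    ∃ τ : ((StMod.proj _).obj (coker T p) ⟶ (StMod.proj _).obj (coker T r)) →ₗ[k] k,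
      ∀ M : StMod (MonoidAlgebra k G),
        (∀ l : ((StMod.proj _).obj (coker T p) ⟶ M) →ₗ[k] k,
          ∃ ψ : M ⟶ (StMod.proj _).obj (coker T r), ∀ x, τ (x ≫ ψ) = l x) ∧
        ∀ y : M ⟶ (StMod.proj _).obj (coker T r), (∀ a, τ (a ≫ y) = 0) → y = 0 := by
  cases nonempty_fintype G
  have := hT p
  have := hT r
  have := hT (p + 1)
  obtain ⟨σ, hσ⟩ := exists_sumOfConjugatesEquivariant_eq_id (k := k) (G := G) (X := T.X p)
  have hi := cokerι_injective r p (hex (r - 1) r p (by omega) h)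
  have hj := cokerι_injective p (p + 1) (hex (p - 1) p (p + 1) (by omega) rfl)
  have hip := cokerι_exact (T := T) r p h
  have hπ := cokerπ_surjective T p
  let τ₀ : (coker T p ⟶ coker T r) →ₗ[k] k :=
    { toFun := fun f => syzygyTrace σ (cokerι T r p).hom.hom (cokerπ T p).hom.hom f.hom.hom
      map_add' := fun f g => map_add _ f.hom.hom g.hom.hom
      map_smul' := fun c f => map_smul _ c f.hom.hom }
  obtain ⟨τ, hτ⟩ := LinearMap.exists_comp_eq_of_ker_le
    (p := (StMod.proj (MonoidAlgebra k G)).mapLinearMap k (X := coker T p) (Y := coker T r))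
    (StMod.proj _).map_surjective τ₀ (by
      intro f hf
      obtain ⟨Q, hQ, a, b, rfl⟩ := (StMod.proj_map_eq_zero_iff f).1 hf
      exact syzygyTrace_eq_zero_of_factor hσ (LinearMap.ext hip.apply_apply_eq_zero)
        a.hom.hom b.hom.hom)
  replace hτ : ∀ f, τ ((StMod.proj _).map f) = τ₀ f := LinearMap.congr_fun hτ
  refine ⟨τ, fun M => ?_⟩
  obtain ⟨M, rfl⟩ : ∃ M', M = (StMod.proj _).obj M' := ⟨M.as, rfl⟩
  refine ⟨fun l => ?_, fun y hy => ?_⟩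
  · obtain ⟨ψ, hψ⟩ := exists_syzygyTrace_eq hσ hi hip hπ hj
      (l ∘ₗ (StMod.proj _).mapLinearMap k ∘ₗ FGModuleCat.homOfLinear (coker T p) M) (fun z => by
      refine (congrArg l ?_).trans (map_zero l)
      exact StMod.proj_map_eq_zero_of_factor _ _ _ (hT (p + 1)) (cokerι T p (p + 1))
        (FGModuleCat.homOfLinear (k := k) _ _ z) rfl)
    refine ⟨(StMod.proj _).map (FGModuleCat.homOfLinear (k := k) _ _ ψ), fun x => ?_⟩
    obtain ⟨x, rfl⟩ := (StMod.proj _).map_surjective x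
    rw [← Functor.map_comp, hτ]
    exact hψ x.hom.hom
  · obtain ⟨y, rfl⟩ := (StMod.proj _).map_surjective y
    obtain ⟨v, hv⟩ := exists_factor_of_syzygyTrace_eq_zero hσ hi hip hπ (cokerπ_surjective T r)
      y.hom.hom (fun a => by
        have := hy ((StMod.proj _).map (FGModuleCat.homOfLinear (k := k) _ _ a))
        rw [← Functor.map_comp, hτ] at this
        exact this)
    exact StMod.proj_map_eq_zero_of_factor _ _ _ (hT r)
      (FGModuleCat.homOfLinear (k := k) _ _ v) (cokerπ T r) (FGModuleCat.hom_ext hv)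

end StableDuality

/-! ## Thick subcategories -/

section Thick

variable {A : Type u} [Ring A]

lemma StMod.thick_isThick (L : StMod A) : StMod.IsThick (StMod.thick L) where
  retract := ⟨fun r hY P hP hL => by
    have := hP.retract
    exact P.prop_of_retract r (hY P hP hL)⟩
  third f g h hX hY P hP hL := hP.third f g h (hX P hP hL) (hY P hP hL)
  first f g h hX hY P hP hL := hP.first f g h (hX P hP hL) (hY P hP hL)
  middle f g h hX hY P hP hL := hP.middle f g h (hX P hP hL) (hY P hP hL)

lemma StMod.self_mem_thick (L : StMod A) : StMod.thick L L := fun _ _ hL => hL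

lemma StMod.isTriangle_of_exact {L M N : FGModuleCat.{u} A} (i : L ⟶ M) (p : M ⟶ N)
    (hi : Function.Injective i.hom.hom) (h : Function.Exact i.hom.hom p.hom.hom)
    (hp : Function.Surjective p.hom.hom) :
    StMod.IsTriangle ((StMod.proj A).map i) ((StMod.proj A).map p) :=
  ⟨L, M, N, i, p, hi, h, hp, Iso.refl _, Iso.refl _, Iso.refl _, by simp, by simp⟩

lemma StMod.proj_map_eq_of_sub {X Y Q : FGModuleCat.{u} A} {f g : X ⟶ Y}
    (hQ : Module.Projective A Q) (a : X ⟶ Q) (b : Q ⟶ Y) (h : f - g = a ≫ b) :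
    (StMod.proj A).map f = (StMod.proj A).map g :=
  CategoryTheory.Quotient.sound _ ⟨Q, hQ, a, b, h⟩

namespace StMod.IsThick

variable {P : ObjectProperty (StMod A)}

lemma prop_of_iso (hP : StMod.IsThick P) {X Y : StMod A} (e : X ≅ Y) (hX : P X) : P Y :=
  have := hP.retract
  P.prop_of_retract ⟨e.inv, e.hom, e.inv_hom_id⟩ hX

/-- A projective module is a zero object of the stable category, hence a retract of any object. -/
lemma prop_of_projective (hP : StMod.IsThick P) {X : StMod A} (hX : P X) (Q : FGModuleCat.{u} A)
    (hQ : Module.Projective A Q) : P ((StMod.proj A).obj Q) := by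
  have := hP.retract
  have h0 : 𝟙 ((StMod.proj A).obj Q) = 0 := by
    rw [← (StMod.proj A).map_id]
    exact StMod.proj_map_eq_zero_of_factor A _ Q hQ (𝟙 _) (𝟙 _) (by simp)
  exact P.prop_of_retract ⟨0, 0, by rw [h0, Limits.comp_zero]⟩ hX

lemma exists_biproduct (hP : StMod.IsThick P) {X Y : StMod A} (hX : P X) (hY : P Y) :
    ∃ (Z : StMod A) (_ : P Z) (i₁ : X ⟶ Z) (i₂ : Y ⟶ Z) (p₁ : Z ⟶ X) (p₂ : Z ⟶ Y),
      i₁ ≫ p₁ = 𝟙 _ ∧ i₁ ≫ p₂ = 0 ∧ i₂ ≫ p₁ = 0 ∧ i₂ ≫ p₂ = 𝟙 _ := by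
  let F := StMod.proj A
  obtain ⟨X, rfl⟩ : ∃ X', X = F.obj X' := ⟨X.as, rfl⟩
  obtain ⟨Y, rfl⟩ : ∃ Y', Y = F.obj Y' := ⟨Y.as, rfl⟩
  let Z := FGModuleCat.of A (X × Y)
  let i₁ : X ⟶ Z := FGModuleCat.ofHom (LinearMap.inl A X Y)
  let i₂ : Y ⟶ Z := FGModuleCat.ofHom (LinearMap.inr A X Y)
  let p₁ : Z ⟶ X := FGModuleCat.ofHom (LinearMap.fst A X Y)
  let p₂ : Z ⟶ Y := FGModuleCat.ofHom (LinearMap.snd A X Y)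
  have h₁₁ : i₁ ≫ p₁ = 𝟙 _ := rfl
  have h₁₂ : i₁ ≫ p₂ = 0 := rfl
  have h₂₁ : i₂ ≫ p₁ = 0 := rfl
  have h₂₂ : i₂ ≫ p₂ = 𝟙 _ := rfl
  refine ⟨F.obj Z, hP.middle _ _ (StMod.isTriangle_of_exact i₁ p₂ LinearMap.inl_injective ?_
    Prod.snd_surjective) hX hY, F.map i₁, F.map i₂, F.map p₁, F.map p₂, ?_⟩
  · exact Function.Exact.inl_snd
  · simp only [← Functor.map_comp, h₁₁, h₁₂, h₂₁, h₂₂, Functor.map_zero]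
    exact ⟨F.map_id _, trivial, trivial, F.map_id _⟩

/-- Every morphism between objects of a thick subcategory is a weak kernel of a morphism of the
subcategory. -/
lemma exists_weakCokernel (hP : StMod.IsThick P)
    (hA : ∀ M : FGModuleCat.{u} A, ∃ (Q : FGModuleCat.{u} A) (i : M ⟶ Q),
      Module.Projective A Q ∧ Function.Injective i.hom.hom)
    {X Y : StMod A} (hX : P X) (hY : P Y) (g : X ⟶ Y) :
    ∃ (C : StMod A) (_ : P C) (h : Y ⟶ C), g ≫ h = 0 ∧
      ∀ {M : StMod A} (ψ : M ⟶ Y), ψ ≫ h = 0 → ∃ f : M ⟶ X, f ≫ g = ψ := by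
  let F := StMod.proj A
  obtain ⟨X, rfl⟩ : ∃ X', X = F.obj X' := ⟨X.as, rfl⟩
  obtain ⟨Y, rfl⟩ : ∃ Y', Y = F.obj Y' := ⟨Y.as, rfl⟩
  obtain ⟨g, rfl⟩ := F.map_surjective g
  -- Adding a projective hull-like module Q to Y changes nothing stably and makes `g` injective; `C`
  -- is then an honest cokernel and represents the cone.
  obtain ⟨Q, j, hQ, hj⟩ := hA X
  let B := FGModuleCat.of A (Y × Q)
  let i₁ : Y ⟶ B := FGModuleCat.ofHom (LinearMap.inl A Y Q)
  let i₂ : Q ⟶ B := FGModuleCat.ofHom (LinearMap.inr A Y Q)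
  let p₁ : B ⟶ Y := FGModuleCat.ofHom (LinearMap.fst A Y Q)
  let p₂ : B ⟶ Q := FGModuleCat.ofHom (LinearMap.snd A Y Q)
  have h₁₁ : i₁ ≫ p₁ = 𝟙 _ := rfl
  have hid : 𝟙 B - p₁ ≫ i₁ = p₂ ≫ i₂ := by
    rw [sub_eq_iff_eq_add]
    apply FGModuleCat.hom_ext
    refine LinearMap.ext fun x => Prod.ext ?_ ?_
    · exact (zero_add _).symm
    · exact (add_zero _).symm
  let i : X ⟶ B := FGModuleCat.ofHom (g.hom.hom.prod j.hom.hom)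
  have hi : Function.Injective i.hom.hom := fun x y h => hj (congrArg Prod.snd h)
  have hip : i ≫ p₁ = g := rfl
  have hig : i - g ≫ i₁ = j ≫ i₂ := by
    rw [sub_eq_iff_eq_add]
    apply FGModuleCat.hom_ext
    refine LinearMap.ext fun x => Prod.ext ?_ ?_
    · exact (zero_add _).symm
    · exact (add_zero _).symm
  let C := FGModuleCat.of A (B ⧸ LinearMap.range i.hom.hom)
  let p : B ⟶ C := FGModuleCat.ofHom (LinearMap.range i.hom.hom).mkQ
  have hp : Function.Surjective p.hom.hom := Submodule.mkQ_surjective _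
  have hex : Function.Exact i.hom.hom p.hom.hom := LinearMap.exact_map_mkQ_range i.hom.hom
  have hip0 : i ≫ p = 0 := FGModuleCat.hom_ext (LinearMap.ext hex.apply_apply_eq_zero)
  have hB : P (F.obj B) := by
    refine hP.prop_of_iso ⟨F.map i₁, F.map p₁, ?_, ?_⟩ hY
    · rw [← F.map_comp, h₁₁, F.map_id]
    · rw [← F.map_comp, ← F.map_id]
      exact (StMod.proj_map_eq_of_sub hQ p₂ i₂ hid).symm
  refine ⟨F.obj C, hP.third _ _ (StMod.isTriangle_of_exact i p hi hex hp) hX hB,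
    F.map (i₁ ≫ p), ?_, fun {M} ψ hψ => ?_⟩
  · rw [← F.map_comp, ← Category.assoc, F.map_comp, ← StMod.proj_map_eq_of_sub hQ j i₂ hig,
      ← F.map_comp, hip0, F.map_zero]
  · obtain ⟨M, rfl⟩ : ∃ M', M = F.obj M' := ⟨M.as, rfl⟩
    obtain ⟨ψ, rfl⟩ := F.map_surjective ψ
    rw [← F.map_comp] at hψ
    obtain ⟨R, hR, a, b, hab⟩ := (StMod.proj_map_eq_zero_iff _).1 hψ
    -- The composite of `ψ` with the cone map factors through R; lifting `b` along `p` and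
    -- subtracting the result corrects `ψ`, within its stable class, to a map that lands in X.
    obtain ⟨b', hb'⟩ := Module.projective_lifting_property p.hom.hom b.hom.hom hp
    let c : R ⟶ B := FGModuleCat.ofHom b'
    have hc : c ≫ p = b := FGModuleCat.hom_ext hb'
    have hu : (ψ ≫ i₁ - a ≫ c) ≫ p = 0 := by
      rw [Preadditive.sub_comp, Category.assoc, Category.assoc, hc, hab, sub_self]
    obtain ⟨f', hf'⟩ := LinearMap.exists_comp_eq_of_exact hi hex (ψ ≫ i₁ - a ≫ c).hom.hom
      (congrArg (fun f => f.hom.hom) hu)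
    let f : M ⟶ X := FGModuleCat.ofHom f'
    have hf : f ≫ i = ψ ≫ i₁ - a ≫ c := FGModuleCat.hom_ext hf'
    refine ⟨F.map f, ?_⟩
    rw [← F.map_comp]
    refine (StMod.proj_map_eq_of_sub hR a (c ≫ p₁) ?_).symm
    rw [← hip, ← Category.assoc, hf, Preadditive.sub_comp, Category.assoc, h₁₁, Category.comp_id,
      Category.assoc, sub_sub_cancel]

end StMod.IsThick

/-- Consecutive cokernels are the ends of a triangle with projective middle term, so membership
spreads from coker 0 ≅ L in both directions. -/
lemma CompleteResolution.syzygy_mem_thick {L : FGModuleCat.{u} A} (T : CompleteResolution L)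
    (n : ℤ) : StMod.thick ((StMod.proj A).obj L) (T.syzygy n) := by
  have hth := StMod.thick_isThick ((StMod.proj A).obj L)
  have hL := StMod.self_mem_thick ((StMod.proj A).obj L)
  have tri : ∀ p q : ℤ, p + 1 = q → StMod.IsTriangle
      ((StMod.proj A).map (cokerι T.complex p q)) ((StMod.proj A).map (cokerπ T.complex q)) :=
    fun p q h => StMod.isTriangle_of_exact _ _
      (cokerι_injective p q (T.exact (p - 1) p q (by omega) h)) (cokerι_exact p q h)
      (cokerπ_surjective _ _)
  have key : ∀ p : ℤ, StMod.thick ((StMod.proj A).obj L)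
      ((StMod.proj A).obj (coker T.complex p)) := by
    intro p
    induction p using Int.induction_on with
    | zero => exact hth.prop_of_iso ((StMod.proj A).mapIso T.augmentation).symm hL
    | succ p hp =>
      exact hth.third _ _ (tri p (p + 1) rfl) hp (hth.prop_of_projective hL _ (T.projective _))
    | pred p hp =>
      exact hth.first _ _ (tri (-p - 1) (-p) (by omega))
        (hth.prop_of_projective hL _ (T.projective _)) hp
  exact key (-n)

lemma CompleteResolution.GeneratingHypothesis.eq_zero {L : FGModuleCat.{u} A}
    {T : CompleteResolution L} (h : T.GeneratingHypothesis) {X Y : StMod A}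
    (hX : StMod.thick ((StMod.proj A).obj L) X) (hY : StMod.thick ((StMod.proj A).obj L) Y)
    (f : X ⟶ Y) (hf : ∀ (n : ℤ) (x : T.syzygy n ⟶ X), x ≫ f = 0) : f = 0 := by
  have : T.tateCohomologyThick.Faithful := h
  have key := T.tateCohomologyThick.map_injective (X := ⟨X, hX⟩) (Y := ⟨Y, hY⟩)
    (a₁ := ObjectProperty.homMk f) (a₂ := ObjectProperty.homMk 0) (by
      apply GrMod.Hom.ext
      funext n
      ext x
      exact (hf n x).trans (Limits.comp_zero (f := x)).symm)
  exact congrArg (fun f => f.hom) key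

end Thick

/-! ## The generating hypothesis implies fullness -/

section Full

variable {k G : Type u} [Field k] [Group G] [Finite G]
  {L : FGModuleCat.{u} (MonoidAlgebra k G)} (T : CompleteResolution L)

/-- By lifting to graded chain maps. Linearity over the ring thus means naturality with respect to
all stable maps between syzygies. -/
lemma CompleteResolution.exists_syzygyMap_eq {m n l : ℤ} (h : m + n = l)
    (b : T.syzygy l ⟶ T.syzygy n) : ∃ a : T.ring m, T.syzygyMap h a = b := by
  obtain ⟨b, rfl⟩ := (StMod.proj _).map_surjective b
  obtain ⟨a, ha⟩ := exists_cokerMap_eq (m := m) exists_extension_to_projective T.projective T.exact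
    (-l) (-n) (by omega) b
  exact ⟨CochainComplex.HomComplex.CohomologyClass.mk a, congrArg (StMod.proj _).map ha⟩

/-- The components of a homomorphism of Tate cohomology modules. -/
def CompleteResolution.appHom {M N : StMod (MonoidAlgebra k G)}
    (φ : T.tateCohomology.obj M ⟶ T.tateCohomology.obj N) (n : ℤ) :
    (T.syzygy n ⟶ M) →+ (T.syzygy n ⟶ N) :=
  GrMod.Hom.app φ n

/-- Homomorphisms of Tate cohomology modules commute with all maps between syzygies. -/
lemma CompleteResolution.appHom_comp {M N : StMod (MonoidAlgebra k G)}
    (φ : T.tateCohomology.obj M ⟶ T.tateCohomology.obj N) {l n : ℤ}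
    (b : T.syzygy l ⟶ T.syzygy n) (x : T.syzygy n ⟶ M) :
    T.appHom φ l (b ≫ x) = b ≫ T.appHom φ n x := by
  obtain ⟨m, hm⟩ : ∃ m, m + n = l := ⟨l - n, by omega⟩
  subst hm
  obtain ⟨a, rfl⟩ := T.exists_syzygyMap_eq rfl b
  exact GrMod.Hom.map_smul φ a x

section Duality

variable {m n : ℤ} {M N : StMod (MonoidAlgebra k G)}

lemma CompleteResolution.exists_duality (h : m + 1 = n) :
    ∃ τ : (T.syzygy m ⟶ T.syzygy n) →ₗ[k] k,
      ∀ M : StMod (MonoidAlgebra k G),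
        (∀ l : (T.syzygy m ⟶ M) →ₗ[k] k,
          ∃ ψ : M ⟶ T.syzygy n, ∀ x, τ (x ≫ ψ) = l x) ∧
        ∀ y : M ⟶ T.syzygy n, (∀ a, τ (a ≫ y) = 0) → y = 0 :=
  exists_stable_duality T.projective T.exact (-m) (-n) (by omega)

/-- Maps into the syzygies detect elements of Tate cohomology. -/
lemma CompleteResolution.eq_zero_of_comp_eq_zero (x : T.syzygy n ⟶ M)
    (hx : ∀ (j : ℤ) (g : M ⟶ T.syzygy j), x ≫ g = 0) : x = 0 := by
  obtain ⟨τ, hτ⟩ := T.exists_duality (m := n) rfl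
  refine (Module.forall_dual_apply_eq_zero_iff k x).1 (fun l => ?_)
  obtain ⟨ψ, hψ⟩ := (hτ M).1 l
  rw [← hψ, hx, map_zero]

/-- The composition of a homomorphism of Tate cohomology modules with the homomorphism induced
by a map into a syzygy is induced by a map. -/
lemma CompleteResolution.exists_comp_eq_appHom_comp
    (φ : T.tateCohomology.obj M ⟶ T.tateCohomology.obj N) {j : ℤ} (g : N ⟶ T.syzygy j) :
    ∃ ψ : M ⟶ T.syzygy j, ∀ (n : ℤ) (x : T.syzygy n ⟶ M),
      x ≫ ψ = T.appHom φ n x ≫ g := by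
  obtain ⟨τ, hτ⟩ := T.exists_duality (m := j - 1) (n := j) (by omega)
  -- A priori `φ` is only additive; it is k-linear because scalars are endomorphisms of the syzygy.
  let φ' : (T.syzygy (j - 1) ⟶ M) →ₗ[k] (T.syzygy (j - 1) ⟶ N) :=
    { toFun := T.appHom φ (j - 1)
      map_add' := map_add _
      map_smul' := fun c x => by
        have := T.appHom_comp φ (c • 𝟙 (T.syzygy (j - 1))) x
        rw [Linear.smul_comp, Linear.smul_comp, Category.id_comp, Category.id_comp] at this
        exact this }
  -- `ψ` represents the form x ↦ τ(φ(x) ≫ g) in degree j - 1. In degree n the difference of the two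
  -- sides pairs to zero with every a : Ω^{j-1} L → Ωⁿ L, since a ≫ φ(x) = φ(a ≫ x); nondegeneracy
  -- finishes.
  obtain ⟨ψ, hψ⟩ := (hτ M).1 (τ ∘ₗ Linear.rightComp k _ g ∘ₗ φ')
  refine ⟨ψ, fun n x => sub_eq_zero.1 ((hτ (T.syzygy n)).2 _ (fun a => ?_))⟩
  rw [Preadditive.comp_sub, map_sub, sub_eq_zero, ← Category.assoc, ← Category.assoc, hψ,
    ← T.appHom_comp]
  rfl

end Duality

theorem CompleteResolution.full_of_generatingHypothesis (hGH : T.GeneratingHypothesis) :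
    T.tateCohomologyThick.Full := by
  refine ⟨?_⟩
  rintro ⟨M, hM⟩ ⟨N, hN⟩ φ
  change T.tateCohomology.obj M ⟶ T.tateCohomology.obj N at φ
  have hth := StMod.thick_isThick ((StMod.proj _).obj L)
  let Good (I : StMod (MonoidAlgebra k G)) (g : N ⟶ I) (ψ : M ⟶ I) : Prop :=
    StMod.thick ((StMod.proj _).obj L) I ∧ ∀ (n : ℤ) (x : T.syzygy n ⟶ M), x ≫ ψ = T.appHom φ n x ≫ g
  have lift : ∀ I g ψ, Good I g ψ → ∃ f : M ⟶ N, f ≫ g = ψ := by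
    rintro I g ψ ⟨hI, hg⟩
    -- With `h` the cone map of `g`, x ≫ ψ ≫ h = φ(x) ≫ g ≫ h = 0 for all x, so ψ ≫ h = 0 by the
    -- generating hypothesis.
    obtain ⟨C, hC, h, hgh, hlift⟩ := hth.exists_weakCokernel (exists_embedding_of_fg k G) hN hI g
    refine hlift ψ (hGH.eq_zero hM hC _ (fun n x => ?_))
    rw [← Category.assoc, hg, Category.assoc, hgh, Limits.comp_zero]
  let S : Set (Submodule k (M ⟶ N)) :=
    {W | ∃ I g ψ, Good I g ψ ∧ W = LinearMap.ker (Linear.rightComp k M g)}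
  -- The zero pair shows that there are candidates.
  obtain ⟨_, ⟨I, g, ψ, hgood, rfl⟩, hmin⟩ := WellFounded.has_min (wellFounded_lt (α :=
    Submodule k (M ⟶ N))) S ⟨_, N, 0, 0, ⟨hN, fun n x => by simp⟩, rfl⟩
  obtain ⟨f, hf⟩ := lift I g ψ hgood
  have key : ∀ I' g' ψ', Good I' g' ψ' → f ≫ g' = ψ' := by
    intro I' g' ψ' hgood'
    obtain ⟨Z, hZ, i₁, i₂, p₁, p₂, h₁₁, h₁₂, h₂₁, h₂₂⟩ :=
      hth.exists_biproduct hgood.1 hgood'.1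
    have hZgood : Good Z (g ≫ i₁ + g' ≫ i₂) (ψ ≫ i₁ + ψ' ≫ i₂) := by
      refine ⟨hZ, fun n x => ?_⟩
      simp only [Preadditive.comp_add, ← Category.assoc, hgood.2, hgood'.2]
    obtain ⟨f', hf'⟩ := lift _ _ _ hZgood
    have fst : ∀ {X : StMod (MonoidAlgebra k G)} (a : X ⟶ I) (b : X ⟶ I'),
        (a ≫ i₁ + b ≫ i₂) ≫ p₁ = a := fun a b => by
      rw [Preadditive.add_comp, Category.assoc, Category.assoc, h₁₁, h₂₁]
      simp
    have snd : ∀ {X : StMod (MonoidAlgebra k G)} (a : X ⟶ I) (b : X ⟶ I'),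
        (a ≫ i₁ + b ≫ i₂) ≫ p₂ = b := fun a b => by
      rw [Preadditive.add_comp, Category.assoc, Category.assoc, h₁₂, h₂₂]
      simp
    have hfg : f' ≫ g = ψ := by
      rw [← fst g g', ← Category.assoc, hf', fst]
    have hfg' : f' ≫ g' = ψ' := by
      rw [← snd g g', ← Category.assoc, hf', snd]
    have hle : LinearMap.ker (Linear.rightComp k M (g ≫ i₁ + g' ≫ i₂)) ≤
        LinearMap.ker (Linear.rightComp k M g) := by
      intro u hu
      change u ≫ _ = 0 at hu
      change u ≫ g = 0
      rw [← fst g g', ← Category.assoc, hu, Limits.zero_comp]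
    have hmem : f - f' ∈ LinearMap.ker (Linear.rightComp k M (g ≫ i₁ + g' ≫ i₂)) := by
      -- By minimality, adding `g'` does not shrink the kernel of `g`; as `g` kills `f - f'`, so
      -- does the sum, and hence so does `g'`.
      rw [(hle.lt_or_eq).resolve_left (hmin _ ⟨_, _, _, hZgood, rfl⟩)]
      change (f - f') ≫ g = 0
      rw [Preadditive.sub_comp, hf, hfg, sub_self]
    change (f - f') ≫ _ = 0 at hmem
    have h0 : (f - f') ≫ g' = 0 := by
      rw [← snd g g', ← Category.assoc, hmem, Limits.zero_comp]
    rw [Preadditive.sub_comp, hfg', sub_eq_zero] at h0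
    exact h0
  refine ⟨ObjectProperty.homMk f, ?_⟩
  apply GrMod.Hom.ext
  funext n
  refine AddMonoidHom.ext fun (x : T.syzygy n ⟶ M) => ?_
  change x ≫ f = T.appHom φ n x
  rw [← sub_eq_zero]
  -- It suffices to compare x ≫ f and φ(x) after every map N → Ωʲ L. Each such map belongs to a good
  -- pair, on which `f` is already correct.
  refine T.eq_zero_of_comp_eq_zero _ (fun j h => ?_)
  obtain ⟨ψ', hψ'⟩ := T.exists_comp_eq_appHom_comp φ h
  rw [Preadditive.sub_comp, Category.assoc, key _ h ψ' ⟨T.syzygy_mem_thick j, hψ'⟩, sub_eq_zero]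
  exact hψ' n x

end Full

theorem theorem3p2 (k G : Type u) [Field k] [Group G] [Finite G]
    (p : ℕ) [Fact p.Prime] [CharP k p] (hp : p ∣ Nat.card G)
    (T : CompleteResolution (trivialModule k G)) (hGH : T.GeneratingHypothesis) :
    T.tateCohomologyThick.Full :=
  T.full_of_generatingHypothesis hGH

end
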